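/- Let $\mathbb F_q$ be a finite field, let $e>d\ge 1$ and $1\le k\le d$ be integers, and let $\mathbb A=\{a_1,\dots,a_e\}$ and $\mathbb B=\{b_1,\dots,b_d\}$ be disjoint sets of indeterminates over $\mathbb F_q$. For finite alphabets $\mathbb U,\mathbb V$ (multisets of elements of a commutative ring; $+$ denotes union) define $S^i(\mathbb U-\mathbb V)$ by $\prod_{v\in\mathbb V}(1-zv)\big/\prod_{u\in\mathbb U}(1-zu)=\sum_{i\ge 0}S^i(\mathbb U-\mathbb V)z^i$ and $S^i(\mathbb U-\mathbb V)=0$ for $i<0$; write $S^i(\mathbb U)$ and $S^i(-\mathbb V)$ when the other alphabet is empty. Let $S_{m^n}(\mathbb U-\mathbb V)=\det\big(S^{m+j-h}(\mathbb U-\mathbb V)\big)_{1\le h,j\le n}$. Let $T$ be a further indeterminate, identified with the alphabet $\{T\}$, so that $S^e(T-\mathbb A)=\prod_{i}(T-a_i)$ and $S^d(T-\mathbb B)=\prod_i(T-b_i)$. The $k$-th generic remainder is $$\mathcal R_k=(-1)^{k(e-d+1)}S_{(e-d+k)^{k-1}}(\mathbb B-\mathbb A-T)\,S^e(T-\mathbb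 A)+S_{k^{e-d+k-1}}(\mathbb A-\mathbb B-T)\,S^d(T-\mathbb B)\in\mathbb F_q[\mathbb A,\mathbb B][T].$$ Then $\mathcal R_k$ is, up to a nonzero factor in $\mathbb F_q(\mathbb A,\mathbb B)$, the $k$-th remainder in the Euclidean algorithm applied to $S^e(T-\mathbb A)$ and $S^d(T-\mathbb B)$ in $\mathbb F_q(\mathbb A,\mathbb B)[T]$ (that is, $r_k$, where $r_0=S^d(T-\mathbb B)$, $r_1=S^e(T-\mathbb A)\bmod r_0$ and $r_{i+2}=r_i\bmod r_{i+1}$), and $\deg_T\mathcal R_k=d-k$. Let $F_k\in\mathbb F_q[\mathbb A,\mathbb B]$ be the leading coefficient of $\mathcal R_k$ as a polynomial in $T$, and put $\mathbf S=(S^i(-\mathbb B):1\le i\le d)$ and $\mathbf T=(S^i(\mathbb A):1\le i\le e)$. Then $F_k$ is nonzero and can be written in a unique way as a polynomial in $\mathbf S$ with coefficients in $\mathbb F_q[\mathbf T]$ (more precisely, as $P(\mathbf T,\mathbf S)$ with a unique polynomial $P$ in $e+d$ variables over $\mathbb F_q$); this polynomial has total degree $e-d+k$ in $\mathbf S$,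 and it is monic of degree $e-d+k$ in $S^k(-\mathbb B)$. -/

import Mathlib

open Polynomial

noncomputable section

/-- The function `S^i(𝔸 - 𝔹)` of a formal difference of two alphabets (finite multisets of
elements of a commutative ring), for `i : ℤ`: it is `0` for `i < 0`, and otherwise the coefficient
of `z^i` in `∏_{b ∈ 𝔹} (1 - z b) · ∏_{a ∈ 𝔸} 1 / (1 - z a)`, where
`1 / (1 - z a) = ∑ₙ aⁿ zⁿ`. Thus `complete 𝔸 0 i = S^i(𝔸)` and `complete 0 𝔹 i = S^i(-𝔹)`. -/
def complete {R : Type*} [CommRing R] (A B : Multiset R) (i : ℤ) : R :=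
  if i < 0 then 0
  else PowerSeries.coeff i.toNat
    ((B.map fun b => (1 - PowerSeries.C b * PowerSeries.X : PowerSeries R)).prod *
      (A.map fun a => (PowerSeries.mk fun n => a ^ n : PowerSeries R)).prod)

/-- The Schur function `S_J(𝔸 - 𝔹) = det (S^{j_k + k - h}(𝔸 - 𝔹))_{h,k}`
(row `h`, column `k`). -/
def schur {R : Type*} [CommRing R] {n : ℕ} (J : Fin n → ℕ) (A B : Multiset R) : R :=
  Matrix.det (Matrix.of fun h k : Fin n =>
    complete A B ((J k : ℤ) + ((k : ℕ) : ℤ) - ((h : ℕ) : ℤ)))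

/-- The ring `F[𝔸, 𝔹]` on `e + d` indeterminates. -/
abbrev GenericRing (F : Type*) [Field F] (e d : ℕ) : Type _ :=
  MvPolynomial (Fin e ⊕ Fin d) F

/-- The alphabet `𝔸` of `e` indeterminates. -/
def alphA (F : Type*) [Field F] (e d : ℕ) : Multiset (GenericRing F e d) :=
  (Finset.univ : Finset (Fin e)).val.map fun i => MvPolynomial.X (Sum.inl i)

/-- The alphabet `𝔹` of `d` indeterminates. -/
def alphB (F : Type*) [Field F] (e d : ℕ) : Multiset (GenericRing F e d) :=
  (Finset.univ : Finset (Fin d)).val.map fun i => MvPolynomial.X (Sum.inr i)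

/-- The alphabet `𝔸`, seen in `F[𝔸, 𝔹][T]`. -/
def alphAT (F : Type*) [Field F] (e d : ℕ) : Multiset (GenericRing F e d)[X] :=
  (alphA F e d).map fun a => C a

/-- The alphabet `𝔹`, seen in `F[𝔸, 𝔹][T]`. -/
def alphBT (F : Type*) [Field F] (e d : ℕ) : Multiset (GenericRing F e d)[X] :=
  (alphB F e d).map fun b => C b

/-- The generic monic polynomial `S^e(T - 𝔸)` with set of roots `𝔸`. -/
def genericA (F : Type*) [Field F] (e d : ℕ) : (GenericRing F e d)[X] :=
  complete {X} (alphAT F e d) e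

/-- The generic monic polynomial `S^d(T - 𝔹)` with set of roots `𝔹`. -/
def genericB (F : Type*) [Field F] (e d : ℕ) : (GenericRing F e d)[X] :=
  complete {X} (alphBT F e d) d

/-- The `k`-th remainder `𝓡_k` (for `e > d`, `1 ≤ k ≤ d`), in its denominator-free normalization
`(-1)^{k(e-d+1)} S_{(e-d+k)^{k-1}}(𝔹 - 𝔸 - T) S^e(T - 𝔸)
  + S_{k^{e-d+k-1}}(𝔸 - 𝔹 - T) S^d(T - 𝔹)`. -/
def genericRemainder (F : Type*) [Field F] (e d k : ℕ) : (GenericRing F e d)[X] :=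
  (-1) ^ (k * (e - d + 1)) *
      schur (fun _ : Fin (k - 1) => e - d + k) (alphBT F e d) (alphAT F e d + {X}) *
      genericA F e d +
    schur (fun _ : Fin (e - d + k - 1) => k) (alphAT F e d) (alphBT F e d + {X}) *
      genericB F e d

/-- The remainder sequence of the Euclidean algorithm applied to `g` and `f` over a field:
`r₀ = f`, `r₁ = g mod f`, `r_{i+2} = r_i mod r_{i+1}`. -/
def euclidRem {K : Type*} [Field K] (g f : K[X]) : ℕ → K[X]
  | 0 => f
  | 1 => g % f
  | n + 2 => euclidRem g f n % euclidRem g f (n + 1)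

/-- The element of `F[𝔸, 𝔹]` obtained from a polynomial `P` in variables `s₁, …, s_d` over
`F[t₁, …, t_e]` by substituting `S^i(𝔸)` for `t_i` and `S^i(-𝔹)` for `s_i`
(the variables are indexed from `0` in the code). -/
def evalTS (F : Type*) [Field F] (e d : ℕ)
    (P : MvPolynomial (Fin d) (MvPolynomial (Fin e) F)) : GenericRing F e d :=
  MvPolynomial.eval₂
    (MvPolynomial.aeval (R := F) fun i : Fin e =>
      complete (alphA F e d) 0 (((i : ℕ) : ℤ) + 1)).toRingHom
    (fun i : Fin d => complete 0 (alphB F e d) (((i : ℕ) : ℤ) + 1)) P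

/-- A multivariate polynomial seen as a univariate polynomial in its `i`-th variable, with
coefficients polynomials in the other variables. -/
def inVariable {σ R : Type*} [CommRing R] [DecidableEq σ] (i : σ) (P : MvPolynomial σ R) :
    (MvPolynomial σ R)[X] :=
  MvPolynomial.eval₂ ((C : MvPolynomial σ R →+* (MvPolynomial σ R)[X]).comp MvPolynomial.C)
    (fun j => if j = i then X else C (MvPolynomial.X j)) P

end

noncomputable section

/-! Put `γ = ∏ (1 - a z)`, `β = ∏ (1 - b z)` and `c = β / γ`, the generating series of `S^i(𝔸 - 𝔹)`.
The two generic polynomials are `γ` and `β` with coefficients reversed, and the determinants in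
`𝓡_k` are Toeplitz determinants of `c` and `c⁻¹`, the extra letter `T` multiplying the series by `1
- T z`.

The adjugate of the Toeplitz matrix of `c` yields a cofactor that completes one term of `𝓡_k` to a
combination of degree at most `d - k`, whose coefficient in degree `d - k` is `det (c_{k+j-h})` of
size `e - d + k` (`exists_cofactor`). Applied to `c⁻¹`, the same lemma completes the other term. The
two leading coefficients agree up to sign by duality of minors of inverse matrices
(`det_toeplitz_eq_of_mul_eq_one`). When none of these determinants vanishes, combinations of small
degree with small cofactors are zero (`combination_eq_zero`), so the two constructions coincide with
`𝓡_k` (`toeplitzRemainder_spec`), and the Euclidean remainders are proportional to them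
(`euclidRem_eq_of_combination`).

The leading coefficient is therefore one determinant, with entries of degree at most one in `𝐒`. The
variable `S^k(-𝔹)` enters through a unitriangular matrix, so its top power has coefficient `1`
(`coeff_inVariable_leadingPoly`). Uniqueness and nonvanishing follow from the algebraic independence
of `𝐒` and `𝐓` (`evalTSHom_injective`). -/

/-- The coefficient of a power series at an integer index, zero for negative indices. -/
def intCoeff {R : Type*} [CommRing R] (c : PowerSeries R) (i : ℤ) : R :=
  if i < 0 then 0 else PowerSeries.coeff i.toNat c

/-- The `n × n` Toeplitz matrix `(c_{p + j - h})_{h, j}`. -/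
def toeplitz {R : Type*} [CommRing R] (c : PowerSeries R) (p n : ℕ) : Matrix (Fin n) (Fin n) R :=
  Matrix.of fun h j => intCoeff c ((p : ℤ) + ((j : ℕ) : ℤ) - ((h : ℕ) : ℤ))

/-! ### Toeplitz minors of a power series and of its inverse. -/

section Toeplitz

variable {R : Type*} [CommRing R]

theorem intCoeff_natCast (c : PowerSeries R) (i : ℕ) :
    intCoeff c (i : ℤ) = PowerSeries.coeff i c := by
  simp [intCoeff]

theorem intCoeff_of_neg (c : PowerSeries R) {i : ℤ} (hi : i < 0) : intCoeff c i = 0 := by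
  simp [intCoeff, hi]

theorem intCoeff_natCast_sub (c : PowerSeries R) (l i : ℕ) :
    intCoeff c ((l : ℤ) - i) = PowerSeries.coeff l (PowerSeries.X ^ i * c) := by
  rw [PowerSeries.coeff_X_pow_mul']
  split_ifs with h
  · rw [← Nat.cast_sub h, intCoeff_natCast]
  · exact intCoeff_of_neg _ (by omega)

theorem sum_intCoeff_mul_intCoeff (c c' : PowerSeries R) {i j N : ℕ} (hj : j < N) :
    ∑ l ∈ Finset.range N, intCoeff c ((l : ℤ) - i) * intCoeff c' ((j : ℤ) - l) =
      intCoeff (c * c') ((j : ℤ) - i) := by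
  rw [intCoeff_natCast_sub, ← mul_assoc, PowerSeries.coeff_mul,
    Finset.Nat.sum_antidiagonal_eq_sum_range_succ
      (fun a b => PowerSeries.coeff a (PowerSeries.X ^ i * c) * PowerSeries.coeff b c')]
  symm
  rw [← Finset.sum_subset (Finset.range_subset_range.2 (Nat.succ_le_of_lt hj))]
  · refine Finset.sum_congr rfl fun l hl => ?_
    have hl' : l ≤ j := by simpa [Nat.lt_succ_iff] using hl
    rw [intCoeff_natCast_sub, ← Nat.cast_sub hl', intCoeff_natCast]
  · intro l _ hl
    rw [intCoeff_of_neg c' (i := (j : ℤ) - l), mul_zero]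
    simp at hl
    omega

theorem val_finRotate_pow (N t : ℕ) (i : Fin N) :
    ((finRotate N ^ t) i : ℕ) = ((i : ℕ) + t) % N := by
  induction t with
  | zero => simp [Nat.mod_eq_of_lt i.2]
  | succ t ih =>
    have := i.neZero
    rw [pow_succ', Equiv.Perm.mul_apply, finRotate_apply, Fin.val_add, ih]
    simp only [Fin.coe_ofNat_eq_mod, Nat.mod_add_mod, Nat.add_mod_mod, add_assoc]

/-- The position of an element of a disjoint union of two intervals laid end to end. -/
def sumPos (k n : ℕ) : Fin k ⊕ Fin n → ℕ := Sum.elim (fun i => (i : ℕ)) fun i => k + (i : ℕ)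

theorem finSumFinEquiv_val (k n : ℕ) (x : Fin k ⊕ Fin n) :
    (finSumFinEquiv x : ℕ) = sumPos k n x := by
  cases x <;> simp [sumPos]

/-- The position preserving bijection between two decompositions of an interval. -/
def sumShift (k n : ℕ) : Fin k ⊕ Fin n ≃ Fin n ⊕ Fin k :=
  finSumFinEquiv.trans ((finCongr (Nat.add_comm k n)).trans finSumFinEquiv.symm)

theorem sumPos_sumShift (k n : ℕ) (x : Fin k ⊕ Fin n) :
    sumPos n k (sumShift k n x) = sumPos k n x := by
  rw [← finSumFinEquiv_val, ← finSumFinEquiv_val]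
  simp [sumShift]

/-- Transported to the interval of length `k + n`, the permutation is the `k`-th power of the cyclic
shift; the part of the exponent not in `n * k` is a product of consecutive integers. -/
theorem sign_sumShift_trans_sumComm (k n : ℕ) :
    Equiv.Perm.sign ((sumShift k n).trans (Equiv.sumComm _ _)) = (-1) ^ (n * k) := by
  rw [← Equiv.Perm.sign_permCongr (finSumFinEquiv (m := k) (n := n))]
  have : (finSumFinEquiv (m := k) (n := n)).permCongr
      ((sumShift k n).trans (Equiv.sumComm _ _)) = finRotate (k + n) ^ k := by
    ext i
    obtain ⟨x, rfl⟩ := finSumFinEquiv.surjective i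
    rw [val_finRotate_pow, Equiv.permCongr_apply, Equiv.symm_apply_apply, finSumFinEquiv_val,
      finSumFinEquiv_val, ← sumPos_sumShift k n x, Equiv.trans_apply]
    generalize sumShift k n x = y
    rcases y with y | y
    · simp only [Equiv.sumComm_apply, Sum.swap_inl, sumPos, Sum.elim_inl, Sum.elim_inr]
      rw [Nat.mod_eq_of_lt (by omega)]
      omega
    · simp only [Equiv.sumComm_apply, Sum.swap_inr, sumPos, Sum.elim_inl, Sum.elim_inr]
      rw [show n + (y : ℕ) + k = y + (k + n) by omega, Nat.add_mod_right,
        Nat.mod_eq_of_lt (by omega)]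
  rw [this, map_pow, sign_finRotate, ← pow_mul]
  rcases k with _ | k
  · simp
  · rw [show (k + 1 + n - 1) * (k + 1) = n * (k + 1) + k * (k + 1) by
      rw [show k + 1 + n - 1 = k + n by omega]; ring, pow_add, (Nat.even_mul_succ_self k).neg_one_pow,
      mul_one]

/-- A rectangular array of coefficients of a power series. -/
def coeffArray {m m' : Type*} (c : PowerSeries R) (r : m → ℕ) (s : m' → ℕ) : Matrix m m' R :=
  Matrix.of fun i j => intCoeff c ((s j : ℤ) - r i)

theorem coeffArray_mul_of_mul_eq_one {c c' : PowerSeries R} (h : c * c' = 1) (n k : ℕ) :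
    coeffArray c (sumPos n k) (sumPos k n) * coeffArray c' (sumPos k n) (sumPos n k) = 1 := by
  ext i j
  have key := sum_intCoeff_mul_intCoeff c c' (i := sumPos n k i) (j := sumPos n k j) (N := k + n)
    (by rw [← finSumFinEquiv_val]; omega)
  rw [Matrix.mul_apply]
  simp only [coeffArray, Matrix.of_apply]
  rw [← (finSumFinEquiv (m := k) (n := n)).symm.sum_comp]
  simp only [← finSumFinEquiv_val k n, Equiv.apply_symm_apply]
  rw [Fin.sum_univ_eq_sum_range
    (fun l : ℕ => intCoeff c ((l : ℤ) - sumPos n k i) * intCoeff c' ((sumPos n k j : ℤ) - l)),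
    key, h, intCoeff_natCast_sub, mul_one, PowerSeries.coeff_X_pow, Matrix.one_apply]
  congr 1
  rw [← finSumFinEquiv_val, ← finSumFinEquiv_val, eq_iff_iff, Fin.val_inj,
    finSumFinEquiv.injective.eq_iff, eq_comm]

/-- Rows and columns cut the same interval at different places. Once the rows are cut like the
columns, the array is upper triangular with `c₀` on the diagonal. -/
theorem det_coeffArray_sumShift {c : PowerSeries R} (hc : PowerSeries.coeff 0 c = 1) (n k : ℕ) :
    ((coeffArray c (sumPos n k) (sumPos k n)).submatrix (sumShift k n) id).det = 1 := by
  rw [← Matrix.det_submatrix_equiv_self (finSumFinEquiv (m := k) (n := n)).symm,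
    Matrix.det_of_isUpperTriangular]
  · refine Finset.prod_eq_one fun i _ => ?_
    simp [coeffArray, sumPos_sumShift, ← finSumFinEquiv_val k n, intCoeff, hc]
  · intro i j hij
    simp only [id] at hij
    simp only [coeffArray, sumPos_sumShift, ← finSumFinEquiv_val k n, Matrix.submatrix_apply,
      Matrix.of_apply, id, Equiv.apply_symm_apply]
    exact intCoeff_of_neg _ (by have : (j : ℕ) < i := hij; omega)

/-- Duality between rectangular Toeplitz determinants of a series and of its inverse. -/
theorem det_toeplitz_eq_of_mul_eq_one {c c' : PowerSeries R} (hc : PowerSeries.coeff 0 c = 1)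
    (h : c * c' = 1) (n k : ℕ) :
    (toeplitz c k n).det = (-1) ^ (n * k) * (toeplitz c' n k).det := by
  set M := coeffArray c (sumPos n k) (sumPos k n) with hM
  set M' := coeffArray c' (sumPos k n) (sumPos n k) with hM'
  have hmul : M * M' = 1 := coeffArray_mul_of_mul_eq_one h n k
  have hQ : M.toBlocks₁₂ = toeplitz c k n := by
    ext i j
    simp [hM, Matrix.toBlocks₁₂, coeffArray, toeplitz, sumPos]
  have hQ' : M'.toBlocks₁₂ = toeplitz c' n k := by
    ext i j
    simp [hM', Matrix.toBlocks₁₂, coeffArray, toeplitz, sumPos]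
  -- Jacobi's argument for complementary minors: keep only the second block column of `M'`, complete
  -- it by identity columns, and compare determinants.
  have key : M * Matrix.fromBlocks M'.toBlocks₁₂ 0 M'.toBlocks₂₂ 1 =
      Matrix.fromBlocks 0 M.toBlocks₁₂ 1 M.toBlocks₂₂ := by
    rw [← Matrix.fromBlocks_toBlocks M, ← Matrix.fromBlocks_toBlocks M',
      Matrix.fromBlocks_multiply, ← Matrix.fromBlocks_one, Matrix.fromBlocks_inj] at hmul
    conv_lhs => rw [← Matrix.fromBlocks_toBlocks M]
    rw [Matrix.fromBlocks_multiply, hmul.2.1, hmul.2.2.2]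
    simp
  have h1 : (M * Matrix.fromBlocks M'.toBlocks₁₂ 0 M'.toBlocks₂₂ 1).submatrix (sumShift k n)
      (id : _ → Fin k ⊕ Fin n) =
      M.submatrix (sumShift k n) id * Matrix.fromBlocks M'.toBlocks₁₂ 0 M'.toBlocks₂₂ 1 := rfl
  have h2 : (Matrix.fromBlocks 0 M.toBlocks₁₂ 1 M.toBlocks₂₂).submatrix (sumShift k n)
      (id : _ → Fin k ⊕ Fin n) =
      (Matrix.fromBlocks 1 M.toBlocks₂₂ 0 M.toBlocks₁₂).submatrix
        ((sumShift k n).trans (Equiv.sumComm _ _)) id := by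
    ext i j
    simp only [Matrix.submatrix_apply, Equiv.trans_apply, id]
    generalize sumShift k n i = y
    rcases y with y | y <;> rcases j with j | j <;> rfl
  have hdet : (M.submatrix (sumShift k n) id).det = 1 := det_coeffArray_sumShift hc n k
  have key2 : ((M * Matrix.fromBlocks M'.toBlocks₁₂ 0 M'.toBlocks₂₂ 1).submatrix (sumShift k n)
      (id : _ → Fin k ⊕ Fin n)).det =
      ((Matrix.fromBlocks 0 M.toBlocks₁₂ 1 M.toBlocks₂₂).submatrix (sumShift k n)
      (id : _ → Fin k ⊕ Fin n)).det := by rw [key]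
  rw [h1, h2, Matrix.det_mul, hdet, one_mul, Matrix.det_permute, sign_sumShift_trans_sumComm,
    Matrix.det_fromBlocks_zero₁₂, Matrix.det_fromBlocks_zero₂₁, Matrix.det_one, Matrix.det_one,
    one_mul, mul_one, hQ, hQ'] at key2
  rw [key2, ← mul_assoc]
  simp [← pow_add, ← two_mul]

end Toeplitz

/-! ### Cofactors obtained from the adjugate of a Toeplitz matrix. -/

/-- The polynomial `∑_{i + j = m} γ_i X^j`. -/
def homPoly {R : Type*} [CommRing R] (γ : PowerSeries R) (m : ℕ) : R[X] :=
  ∑ p ∈ Finset.HasAntidiagonal.antidiagonal m, C (PowerSeries.coeff p.1 γ) * X ^ p.2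

/-- The matrix `(c_{p + j - h} - X c_{p + j - h - 1})_{h, j}`. -/
def toeplitzSub {R : Type*} [CommRing R] (c : PowerSeries R) (p n : ℕ) :
    Matrix (Fin n) (Fin n) R[X] :=
  Matrix.of fun h j => C (intCoeff c ((p : ℤ) + ((j : ℕ) : ℤ) - ((h : ℕ) : ℤ))) -
    X * C (intCoeff c ((p : ℤ) + ((j : ℕ) : ℤ) - ((h : ℕ) : ℤ) - 1))

section Remainder

variable {R : Type*} [CommRing R]

theorem coeff_homPoly (γ : PowerSeries R) (m i : ℕ) :
    (homPoly γ m).coeff i = intCoeff γ ((m : ℤ) - i) := by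
  rw [homPoly, finsetSum_coeff]
  simp only [coeff_C_mul_X_pow]
  by_cases h : i ≤ m
  · rw [Finset.sum_eq_single (m - i, i)]
    · rw [if_pos rfl, ← Nat.cast_sub h, intCoeff_natCast]
    · rintro ⟨a, b⟩ hab hne
      rw [if_neg]
      rintro rfl
      apply hne
      simp only [Finset.HasAntidiagonal.mem_antidiagonal] at hab
      simp [← hab]
    · intro h'
      simp [h] at h'
  · rw [intCoeff_of_neg _ (by omega)]
    refine Finset.sum_eq_zero ?_
    rintro ⟨a, b⟩ hab
    simp only [Finset.HasAntidiagonal.mem_antidiagonal] at hab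
    rw [if_neg (by omega)]

/-- Reversed, both sides are `c * γ`, except that on the right `c` is truncated after `c_m`. The
coefficient in degree `i ≥ e` only involves series indices up to `e + m - i ≤ m`, where the
truncation is invisible. -/
theorem coeff_X_pow_mul_homPoly_sub {c γ : PowerSeries R} {d e m s : ℕ}
    (hγ : ∀ i, e < i → PowerSeries.coeff i γ = 0)
    (hβ : ∀ i, d < i → PowerSeries.coeff i (c * γ) = 0) (h : e + m = s + d) {i : ℕ}
    (hi : e ≤ i) :
    (X ^ s * homPoly (c * γ) d).coeff i = (homPoly γ e * homPoly c m).coeff i := by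
  have h1 : (X ^ s * homPoly (c * γ) d).coeff i = intCoeff (c * γ) (((e + m : ℕ) : ℤ) - i) := by
    rw [coeff_X_pow_mul', h]
    split_ifs with hs
    · rw [coeff_homPoly]
      congr 1
      omega
    · rw [show ((s + d : ℕ) : ℤ) - i = ((s + d - i : ℕ) : ℤ) by omega, intCoeff_natCast,
        hβ _ (by omega)]
  have h2 : (homPoly γ e * homPoly c m).coeff i =
      ∑ l ∈ Finset.range (e + 1), intCoeff γ l * intCoeff c ((e + m : ℤ) - i - l) := by
    rw [coeff_mul, Finset.Nat.sum_antidiagonal_eq_sum_range_succ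
      (fun a b => (homPoly γ e).coeff a * (homPoly c m).coeff b),
      ← Finset.sum_subset (Finset.range_subset_range.2 (Nat.succ_le_succ hi)),
      ← Finset.sum_range_reflect]
    · refine Finset.sum_congr rfl fun l hl => ?_
      have hl' : l ≤ e := by simpa [Nat.lt_succ_iff] using hl
      rw [coeff_homPoly, coeff_homPoly]
      congr 2 <;> push_cast <;> omega
    · intro l _ hl
      rw [coeff_homPoly, intCoeff_of_neg _ (by simp at hl; omega), zero_mul]
  rw [h1, h2]
  by_cases hm : i ≤ e + m
  · obtain ⟨t, ht⟩ := Nat.exists_eq_add_of_le hm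
    have key := sum_intCoeff_mul_intCoeff γ c (i := 0) (j := t) (N := e + 1 + t) (by omega)
    rw [mul_comm c γ, show ((e + m : ℕ) : ℤ) - i = (t : ℤ) - (0 : ℕ) by omega, ← key]
    symm
    rw [← Finset.sum_subset (Finset.range_subset_range.2 (Nat.le_add_right (e + 1) t))]
    · refine Finset.sum_congr rfl fun l _ => ?_
      rw [show (e + m : ℤ) - i - l = (t : ℤ) - l by omega, Nat.cast_zero, sub_zero]
    · intro l _ hl
      rw [Nat.cast_zero, sub_zero, intCoeff_natCast, hγ l (by simp at hl; omega), zero_mul]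
  · rw [intCoeff_of_neg _ (by omega)]
    symm
    exact Finset.sum_eq_zero fun l _ => by rw [intCoeff_of_neg c (by omega), mul_zero]

/-- Subtracting `X` times the preceding column from each column turns the row `1, X, X², …` into `1,
0, 0, …`. -/
theorem det_toeplitzSub (c : PowerSeries R) (k N : ℕ) :
    (toeplitzSub c k N).det =
      (((toeplitz c k (N + 1)).map C).updateRow 0 fun j => (X : R[X]) ^ (j : ℕ)).det := by
  set A := ((toeplitz c k (N + 1)).map C).updateRow 0 fun j => (X : R[X]) ^ (j : ℕ) with hA
  set B : Matrix (Fin (N + 1)) (Fin (N + 1)) R[X] := Matrix.of fun i =>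
    Fin.cons (A i 0) fun j => A i j.succ - X * A i j.castSucc with hB
  have hAB : A.det = B.det := by
    refine Matrix.det_eq_of_forall_col_eq_smul_add_pred (fun _ => X) ?_ ?_
    · intro i; simp [hB]
    · intro i j; simp [hB]
  rw [hAB, Matrix.det_succ_row_zero, Finset.sum_eq_single 0]
  · have h00 : B 0 0 = 1 := by simp [hB, hA]
    rw [h00]
    simp only [Fin.val_zero, pow_zero, one_mul]
    congr 1
    ext1 i j
    simp only [toeplitzSub, Matrix.of_apply, Matrix.submatrix_apply, hB, hA, Fin.succAbove_zero,
      Fin.cons_succ]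
    rw [Matrix.updateRow_ne (Fin.succ_ne_zero i)]
    simp only [toeplitz, Matrix.map_apply, Matrix.of_apply, Fin.val_succ, Fin.val_castSucc]
    rw [show (k : ℤ) + ((j + 1 : ℕ) : ℤ) - ((i + 1 : ℕ) : ℤ) = k + (j : ℕ) - (i : ℕ) by
      push_cast; ring, show (k : ℤ) + (j : ℕ) - ((i + 1 : ℕ) : ℤ) = k + (j : ℕ) - (i : ℕ) - 1 by
      push_cast; ring]
  · intro j _ hj
    obtain ⟨j, rfl⟩ := Fin.exists_succ_eq.2 hj
    have : B 0 j.succ = 0 := by simp [hB, hA, pow_succ']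
    rw [this]
    simp
  · simp

theorem det_toeplitzSub_eq_sum (c : PowerSeries R) (k N : ℕ) :
    (toeplitzSub c k N).det =
      ∑ j : Fin (N + 1), C ((toeplitz c k (N + 1)).adjugate j 0) * X ^ (j : ℕ) := by
  rw [det_toeplitzSub, ← Matrix.cramer_transpose_apply, Matrix.cramer_eq_adjugate_mulVec,
    ← Matrix.adjugate_transpose]
  have : (((toeplitz c k (N + 1)).map C).adjugate) =
      ((toeplitz c k (N + 1)).adjugate.map (C : R →+* R[X])) :=
    ((C : R →+* R[X]).map_adjugate _).symm
  rw [this, Matrix.mulVec, dotProduct]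
  simp only [Matrix.transpose_apply, Matrix.map_apply]

theorem natDegree_det_toeplitzSub_le (c : PowerSeries R) (k N : ℕ) :
    (toeplitzSub c k N).det.natDegree ≤ N := by
  rw [det_toeplitzSub_eq_sum]
  refine natDegree_sum_le_of_forall_le _ _ fun j _ => ?_
  exact (natDegree_C_mul_X_pow_le _ _).trans (Nat.lt_succ_iff.1 j.2)

/-- In degrees at least `e`, each `X ^ (N + 1 + j) * f` agrees with `g` times a reversed truncation
of `c`. Weighting by the first adjugate column gives `Z * g` on the right, where `Z = det A + X ^ (N
+ 1) * Y`; hence `X ^ (N + 1) * (D * f - Y * g)`, with `D` the determinant of `toeplitzSub`, agrees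
with `det A * g` in these degrees. -/
theorem exists_cofactor {c γ : PowerSeries R} {d e N k r : ℕ}
    (hγ : ∀ i, e < i → PowerSeries.coeff i γ = 0) (hγ0 : PowerSeries.coeff 0 γ = 1)
    (hβ : ∀ i, d < i → PowerSeries.coeff i (c * γ) = 0) (he : e = N + 1 + r) (hd : d = k + r) :
    ∃ U : R[X], U.degree < k ∧
      ((toeplitzSub c k N).det * homPoly (c * γ) d + U * homPoly γ e).natDegree ≤ r ∧
      ((toeplitzSub c k N).det * homPoly (c * γ) d + U * homPoly γ e).coeff r =
        (toeplitz c k (N + 1)).det := by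
  set A := toeplitz c k (N + 1) with hA
  set f := homPoly (c * γ) d with hf
  set g := homPoly γ e with hg
  set Z : R[X] := ∑ j : Fin (N + 1), C (A.adjugate j 0) * homPoly c (j + k) with hZ
  have hZc : ∀ p : ℕ, Z.coeff p = ∑ j : Fin (N + 1),
      A.adjugate j 0 * intCoeff c (((j + k : ℕ) : ℤ) - p) := by
    intro p
    simp [hZ, finsetSum_coeff, coeff_C_mul, coeff_homPoly]
  have hZp : ∀ p : Fin (N + 1), Z.coeff p = (A * A.adjugate) p 0 := by
    intro p
    rw [hZc, Matrix.mul_apply]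
    refine Finset.sum_congr rfl fun j _ => ?_
    rw [mul_comm]
    congr 1
    simp only [hA, toeplitz, Matrix.of_apply]
    congr 1
    push_cast
    ring
  -- The coefficients of `Z` in degrees `0, …, N` form the first column of `A * adjugate A = det A •
  -- 1`.
  obtain ⟨Y, hY⟩ : X ^ (N + 1) ∣ Z - C A.det := by
    rw [X_pow_dvd_iff]
    intro p hp
    have := hZp ⟨p, hp⟩
    rw [Matrix.mul_adjugate] at this
    simp only at this
    rw [coeff_sub, this, coeff_C, Matrix.smul_apply, Matrix.one_apply]
    by_cases h0 : p = 0
    · subst h0; simp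
    · rw [if_neg h0, if_neg (by simpa [Fin.ext_iff] using h0)]; simp
  have hYc : ∀ q : ℕ, Y.coeff q = Z.coeff (q + (N + 1)) := by
    intro q
    have := congrArg (fun P => coeff P (q + (N + 1))) hY
    simp only [coeff_sub, coeff_X_pow_mul, coeff_C, Nat.add_eq_zero_iff] at this
    rw [← this]
    simp
  refine ⟨-Y, ?_, ?_⟩
  · rw [degree_neg, degree_lt_iff_coeff_zero]
    intro q hq
    rw [hYc, hZc]
    refine Finset.sum_eq_zero fun j _ => ?_
    rw [intCoeff_of_neg _ (by omega), mul_zero]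
  · have key : ∀ i : ℕ, e ≤ i + (N + 1) →
        ((toeplitzSub c k N).det * f + -Y * g).coeff i = A.det * g.coeff (i + (N + 1)) := by
      intro i hi
      rw [← coeff_X_pow_mul _ (N + 1), ← coeff_C_mul]
      have h1 : X ^ (N + 1) * ((toeplitzSub c k N).det * f + -Y * g) =
          (∑ j : Fin (N + 1), C (A.adjugate j 0) * (X ^ (N + 1 + (j : ℕ)) * f)) - Z * g
            + C A.det * g := by
        rw [det_toeplitzSub_eq_sum, mul_add, ← mul_assoc, ← mul_assoc, mul_neg, ← hY]
        rw [Finset.mul_sum, Finset.sum_mul]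
        have : ∀ j : Fin (N + 1), X ^ (N + 1) * (C (A.adjugate j 0) * X ^ (j : ℕ)) * f =
            C (A.adjugate j 0) * (X ^ (N + 1 + (j : ℕ)) * f) := fun j => by ring
        rw [Finset.sum_congr rfl fun j _ => this j]
        ring
      rw [h1, coeff_add, coeff_sub, hZ, Finset.sum_mul, finsetSum_coeff, finsetSum_coeff]
      simp only [mul_assoc, coeff_C_mul]
      rw [sub_eq_zero.2, zero_add]
      refine Finset.sum_congr rfl fun j _ => ?_
      rw [coeff_X_pow_mul_homPoly_sub hγ hβ (m := j + k) (by omega) hi, mul_comm g]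
    refine ⟨?_, ?_⟩
    · rw [natDegree_le_iff_coeff_eq_zero]
      intro i hi
      rw [key i (by omega), hg, coeff_homPoly, intCoeff_of_neg _ (by omega), mul_zero]
    · rw [key r (by omega), hg, coeff_homPoly, show (e : ℤ) - ((r + (N + 1) : ℕ) : ℤ) = (0 : ℕ) by omega,
        intCoeff_natCast, hγ0, mul_one]

end Remainder

/-! ### Uniqueness of combinations of small degree. -/

section Unique

variable {R : Type*} [CommRing R] [IsDomain R]

/-- A polynomial combination of small degree, with a cofactor of small degree, vanishes. -/
theorem combination_eq_zero {f g : R[X]} {d : ℕ} (hf : f.degree = d) {S : ℕ → R[X]}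
    (hS : ∀ j, 1 ≤ j → j ≤ d → (S j).degree = ((d - j : ℕ) : WithBot ℕ) ∧
      ∃ U V : R[X], U.degree < j ∧ S j = U * g + V * f) :
    ∀ k ≤ d, ∀ U V : R[X], U.degree < k → (U * g + V * f).degree < ((d - k : ℕ) : WithBot ℕ) →
      U * g + V * f = 0 := by
  intro k
  induction k with
  | zero =>
    intro _ U V hU hP
    have hU0 : U = 0 := by
      rw [← degree_eq_bot]; simpa using hU
    subst hU0
    simp only [zero_mul, zero_add, Nat.sub_zero] at hP ⊢
    by_contra hne
    have hV : V ≠ 0 := left_ne_zero_of_mul hne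
    rw [degree_mul, hf, degree_eq_natDegree hV] at hP
    have : V.natDegree + d < d := by exact_mod_cast hP
    omega
  | succ k ih =>
    intro hk U V hU hP
    obtain ⟨hdeg, U', V', hU', hS'⟩ := hS (k + 1) (by omega) hk
    set P := U * g + V * f with hPdef
    by_contra hne
    have hSne : S (k + 1) ≠ 0 := by
      intro h0; rw [h0, degree_zero] at hdeg; exact absurd hdeg (by simp)
    have hfne : f ≠ 0 := by
      intro h0; rw [h0, degree_zero] at hf; exact absurd hf (by simp)
    have hPn : P.natDegree < d - (k + 1) := by
      rw [degree_eq_natDegree hne] at hP; exact_mod_cast hP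
    have hSn : (S (k + 1)).natDegree = d - (k + 1) := natDegree_eq_of_degree_eq_some hdeg
    have natDeg_lt : ∀ {W : R[X]}, W.degree < ((k + 1 : ℕ) : WithBot ℕ) → W.natDegree ≤ k := by
      intro W hW
      by_cases hW0 : W = 0
      · simp [hW0]
      · rw [degree_eq_natDegree hW0] at hW
        have : W.natDegree < k + 1 := by exact_mod_cast hW
        omega
    have hfn : f.natDegree = d := natDegree_eq_of_degree_eq_some hf
    have hzero : ∀ W : R[X], (W * f).natDegree < d → W * f = 0 := by
      intro W hW
      by_contra h0
      rw [natDegree_mul (left_ne_zero_of_mul h0) hfne, hfn] at hW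
      omega
    -- Eliminating `g` leaves a multiple of `f` of degree below `d`, hence zero. As `P` has smaller
    -- degree than `S (k + 1)`, this forces `U` to have smaller degree than `U'`, and the induction
    -- applies.
    have heq : U' * P = U * S (k + 1) := by
      have h1 : U' * P - U * S (k + 1) = (U' * V - U * V') * f := by
        rw [hS', hPdef]; ring
      have h2 := hzero (U' * V - U * V') (by
        rw [← h1]
        have a1 := natDegree_mul_le (p := U') (q := P)
        have a2 := natDegree_mul_le (p := U) (q := S (k + 1))
        have a3 := natDegree_sub_le (U' * P) (U * S (k + 1))
        have a4 := natDeg_lt hU'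
        have a5 := natDeg_lt hU
        have : max (U' * P).natDegree (U * S (k + 1)).natDegree < d := by
          rw [max_lt_iff]; omega
        omega)
      rw [← h1] at h2
      exact sub_eq_zero.1 h2
    have hU'ne : U' ≠ 0 := by
      rintro rfl
      rw [zero_mul, zero_add] at hS'
      exact hSne (hS' ▸ hzero V' (by rw [← hS', hSn]; omega))
    have hUne : U ≠ 0 := by
      rintro rfl
      rw [zero_mul] at heq
      exact mul_ne_zero hU'ne hne heq
    have hlt : U.natDegree < k := by
      have := congrArg natDegree heq
      rw [natDegree_mul hU'ne hne, natDegree_mul hUne hSne] at this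
      have := natDeg_lt hU'
      omega
    refine hne (ih (by omega) U V ?_ ?_)
    · rw [degree_eq_natDegree hUne]; exact_mod_cast hlt
    · rw [← hPdef, degree_eq_natDegree hne]
      exact_mod_cast (show P.natDegree < d - k by omega)

/-- The nonzero constant `P` plays the role of a resultant: `U * P` is a multiple of `f`, too small
in degree unless it vanishes. -/
theorem cofactor_eq_zero {f g : R[X]} {d : ℕ} (hf : f.degree = d) {P U' V' : R[X]}
    (hP : P.degree = 0) (hP' : P = U' * g + V' * f) {U V : R[X]} (hU : U.degree < d)
    (h : U * g + V * f = 0) : U = 0 := by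
  have h1 : U * P = (U * V' - U' * V) * f := by
    have : U * P = (U * V' - U' * V) * f + U' * (U * g + V * f) := by rw [hP']; ring
    rw [this, h, mul_zero, add_zero]
  by_contra hne
  have h2 := congrArg degree h1
  rw [degree_mul, hP, add_zero, degree_mul, hf] at h2
  have hW : (U * V' - U' * V) ≠ 0 := by
    intro h0
    rw [h0, degree_zero, WithBot.bot_add, degree_eq_bot] at h2
    exact hne h2
  rw [degree_eq_natDegree hne, degree_eq_natDegree hW] at h2
  rw [degree_eq_natDegree hne] at hU
  have h3 : U.natDegree = (U * V' - U' * V).natDegree + d := by exact_mod_cast h2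
  have h4 : U.natDegree < d := by exact_mod_cast hU
  omega

end Unique

/-! ### Comparison with the Euclidean algorithm. -/

section Euclid

variable {K : Type*} [Field K]

theorem dvd_of_dvd_euclidRem {g f p : K[X]} :
    ∀ k : ℕ, p ∣ euclidRem g f k → p ∣ euclidRem g f (k + 1) → p ∣ f ∧ p ∣ g := by
  intro k
  induction k with
  | zero =>
    intro h0 h1
    exact ⟨h0, (EuclideanDomain.dvd_mod_iff h0).1 h1⟩
  | succ k ih =>
    intro h0 h1
    exact ih ((EuclideanDomain.dvd_mod_iff h0).1 h1) h0

/-- The degrees of `p` and `q` differ by one, so the quotient has degree at most one and the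
cofactor bound grows by only one. -/
theorem exists_cofactor_mod {f g U₀ V₀ U₁ V₁ p q : K[X]} {d k : ℕ} (hk : k + 2 ≤ d)
    (hp : p = U₀ * g + V₀ * f) (hq : q = U₁ * g + V₁ * f) (hU₀ : U₀.degree < (k : ℕ))
    (hU₁ : U₁.degree < ((k + 1 : ℕ) : WithBot ℕ)) (hpd : p.degree = ((d - k : ℕ) : WithBot ℕ))
    (hqd : q.degree = ((d - (k + 1) : ℕ) : WithBot ℕ)) :
    ∃ U V : K[X], U.degree < ((k + 2 : ℕ) : WithBot ℕ) ∧ p % q = U * g + V * f := by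
  refine ⟨U₀ - p / q * U₁, V₀ - p / q * V₁, ?_, ?_⟩
  · have hdiv : (p / q).degree ≤ 1 := by
      have hqne : q ≠ 0 := by
        intro h0; rw [h0, degree_zero] at hqd; exact absurd hqd (by simp)
      have h1 := degree_add_div hqne (p := p) (by rw [hpd, hqd]; exact_mod_cast (by omega))
      by_cases h0 : p / q = 0
      · simp [h0]
      · rw [hqd, hpd, degree_eq_natDegree h0] at h1
        have : d - (k + 1) + (p / q).natDegree = d - k := by exact_mod_cast h1
        rw [degree_eq_natDegree h0]
        exact_mod_cast (show (p / q).natDegree ≤ 1 by omega)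
    refine (degree_sub_le _ _).trans_lt (max_lt (hU₀.trans (by exact_mod_cast (by omega))) ?_)
    by_cases hU : U₁ = 0
    · rw [hU, mul_zero, degree_zero]; exact WithBot.bot_lt_coe _
    · rw [degree_mul, degree_eq_natDegree hU] at *
      have : U₁.natDegree < k + 1 := by exact_mod_cast hU₁
      calc (p / q).degree + (U₁.natDegree : WithBot ℕ)
          ≤ 1 + (U₁.natDegree : WithBot ℕ) := by gcongr
        _ < ((k + 2 : ℕ) : WithBot ℕ) := by exact_mod_cast (by omega)
  · have := EuclideanDomain.div_add_mod p q
    have h2 : p % q = p - q * (p / q) := by rw [eq_sub_iff_add_eq, add_comm]; exact this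
    rw [h2]
    generalize p / q = t
    rw [hp, hq]
    ring

/-- The remainders of the Euclidean algorithm are determined up to a scalar by the existence of
polynomial combinations with the expected degrees. -/
theorem euclidRem_eq_of_combination {f g : K[X]} {d : ℕ} (hf : f.degree = d) {S : ℕ → K[X]}
    (hS : ∀ j, 1 ≤ j → j ≤ d → (S j).degree = ((d - j : ℕ) : WithBot ℕ) ∧
      ∃ U V : K[X], U.degree < j ∧ S j = U * g + V * f) {k : ℕ} (hk1 : 1 ≤ k) (hkd : k ≤ d) :
    ∃ c : K, c ≠ 0 ∧ S k = C c * euclidRem g f k := by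
  -- The algorithm cannot stop early: a common divisor of this degree would divide `S j`, which is
  -- nonzero of smaller degree.
  have not_dvd : ∀ j, 1 ≤ j → j ≤ d → ∀ p : K[X], p.degree = ((d - (j - 1) : ℕ) : WithBot ℕ) →
      p ∣ f → p ∣ g → False := by
    intro j hj hjd p hp hpf hpg
    obtain ⟨hdeg, U, V, -, hUV⟩ := hS j hj hjd
    have hdvd : p ∣ S j := hUV ▸ dvd_add (hpg.mul_left U) (hpf.mul_left V)
    have hne : S j ≠ 0 := by
      intro h0; rw [h0, degree_zero] at hdeg; exact absurd hdeg (by simp)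
    have := degree_le_of_dvd hdvd hne
    rw [hp, hdeg] at this
    have : d - (j - 1) ≤ d - j := by exact_mod_cast this
    omega
  -- Nor can a degree be skipped: a nonzero combination below degree `d - j` contradicts
  -- `combination_eq_zero`. So each division lowers the degree by exactly one.
  have lt_or_eq : ∀ j, 1 ≤ j → j ≤ d → ∀ p : K[X],
      p.degree < ((d - (j - 1) : ℕ) : WithBot ℕ) → p ≠ 0 →
      (∃ U V : K[X], U.degree < j ∧ p = U * g + V * f) →
      p.degree = ((d - j : ℕ) : WithBot ℕ) := by
    rintro j hj hjd p hp hne ⟨U, V, hU, hUV⟩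
    have h1 : ¬ p.degree < ((d - j : ℕ) : WithBot ℕ) := by
      intro hlt
      rw [hUV] at hlt
      exact hne (hUV.trans (combination_eq_zero hf hS j hjd U V hU hlt))
    rw [degree_eq_natDegree hne] at hp h1 ⊢
    have h2 : p.natDegree < d - (j - 1) := by exact_mod_cast hp
    have h3 : ¬ p.natDegree < d - j := by exact_mod_cast h1
    rw [show p.natDegree = d - j by omega]
  have main : ∀ j ≤ d, ((∃ U V : K[X], U.degree < j ∧ euclidRem g f j = U * g + V * f) ∧
      (euclidRem g f j).degree = ((d - j : ℕ) : WithBot ℕ)) := by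
    intro j
    induction j using Nat.strong_induction_on with
    | _ j ih =>
    intro hj
    rcases j with _ | _ | j
    · exact ⟨⟨0, 1, by simp, by simp [euclidRem]⟩, by simpa [euclidRem] using hf⟩
    · have hfne : f ≠ 0 := by
        intro h0; rw [h0, degree_zero] at hf; exact absurd hf (by simp)
      have hc : ∃ U V : K[X], U.degree < ((1 : ℕ) : WithBot ℕ) ∧ g % f = U * g + V * f := by
        refine ⟨1, -(g / f), by simp, ?_⟩
        have := EuclideanDomain.div_add_mod g f
        linear_combination this
      refine ⟨hc, lt_or_eq 1 le_rfl hj _ ?_ ?_ hc⟩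
      · simpa [hf, euclidRem] using degree_mod_lt g hfne
      · intro h0
        exact not_dvd 1 le_rfl hj f (by simpa using hf) dvd_rfl (EuclideanDomain.mod_eq_zero.1 h0)
    · obtain ⟨⟨U₀, V₀, hU₀, hp⟩, hpd⟩ := ih j (by omega) (by omega)
      obtain ⟨⟨U₁, V₁, hU₁, hq⟩, hqd⟩ := ih (j + 1) (by omega) (by omega)
      have hqne : euclidRem g f (j + 1) ≠ 0 := by
        intro h0; rw [h0, degree_zero] at hqd; exact absurd hqd (by simp)
      have hc := exists_cofactor_mod hj hp hq hU₀ hU₁ hpd hqd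
      refine ⟨hc, lt_or_eq (j + 2) (by omega) hj _ ?_ ?_ hc⟩
      · have := degree_mod_lt (euclidRem g f j) hqne
        rw [hqd] at this
        exact this
      · intro h0
        obtain ⟨h1, h2⟩ := dvd_of_dvd_euclidRem (g := g) (f := f) j
          (EuclideanDomain.mod_eq_zero.1 h0) dvd_rfl
        exact not_dvd (j + 2) (by omega) hj _ hqd h1 h2
  obtain ⟨⟨U, V, hU, hr⟩, hrd⟩ := main k hkd
  obtain ⟨hSd, U', V', hU', hS'⟩ := hS k hk1 hkd
  set r := euclidRem g f k with hrdef
  have hrne : r ≠ 0 := by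
    intro h0; rw [h0, degree_zero] at hrd; exact absurd hrd (by simp)
  have hSne : S k ≠ 0 := by
    intro h0; rw [h0, degree_zero] at hSd; exact absurd hSd (by simp)
  -- With this ratio the leading terms of `S k` and `C c * r` cancel, and the difference is a
  -- combination too small to be nonzero.
  set c := (S k).leadingCoeff / r.leadingCoeff with hc
  have hcne : c ≠ 0 :=
    div_ne_zero (leadingCoeff_ne_zero.2 hSne) (leadingCoeff_ne_zero.2 hrne)
  refine ⟨c, hcne, ?_⟩
  have hcomb : S k - C c * r = (U' - C c * U) * g + (V' - C c * V) * f := by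
    conv_lhs => rw [hS', hr]
    ring
  have hlt : (S k - C c * r).degree < ((d - k : ℕ) : WithBot ℕ) := by
    rw [← hSd]
    refine degree_sub_lt_left ?_ hSne ?_
    · rw [degree_C_mul hcne, hSd, hrd]
    · rw [leadingCoeff_mul, leadingCoeff_C, hc, div_mul_cancel₀ _ (leadingCoeff_ne_zero.2 hrne)]
  rw [hcomb] at hlt
  have hz := combination_eq_zero hf hS k hkd _ _ ?_ hlt
  · rw [← hcomb] at hz
    exact sub_eq_zero.1 hz
  · refine (degree_sub_le _ _).trans_lt (max_lt hU' ?_)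
    rwa [degree_C_mul hcne]

end Euclid

/-! ### The explicit remainder formula. -/

section Remainder

variable {R : Type*} [CommRing R]

theorem degree_eq_of_natDegree_le_of_coeff {p : R[X]} {r : ℕ} (h : p.natDegree ≤ r)
    (hc : p.coeff r ≠ 0) : p.degree = (r : WithBot ℕ) :=
  le_antisymm (degree_le_of_natDegree_le h) (le_degree_of_ne_zero hc)

theorem degree_lt_of_natDegree_le_of_coeff {p : R[X]} {r : ℕ} (h : p.natDegree ≤ r)
    (hc : p.coeff r = 0) : p.degree < (r : WithBot ℕ) :=
  degree_lt_iff_coeff_zero _ _ |>.2 fun m hm => by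
    rcases hm.eq_or_lt with rfl | hlt
    · exact hc
    · exact coeff_eq_zero_of_natDegree_lt (h.trans_lt hlt)

theorem neg_one_pow_mul_succ_eq (a k : ℕ) : (-1 : R) ^ (k * (a + 1)) = (-1) ^ ((a + k) * k) := by
  have : ∀ m : ℕ, (-1 : R) ^ (m * m) = (-1) ^ m := fun m => by
    rw [neg_one_pow_eq_pow_mod_two, neg_one_pow_eq_pow_mod_two (n := m), Nat.mul_mod]
    rcases Nat.mod_two_eq_zero_or_one m with h | h <;> simp [h]
  rw [mul_add, add_mul, pow_add, pow_add, mul_one, this, mul_comm k a]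

/-- The subresultant built from the coefficients of a power series. -/
def toeplitzRemainder (c c' γ β : PowerSeries R) (e d k : ℕ) : R[X] :=
  (-1) ^ (k * (e - d + 1)) * (toeplitzSub c' (e - d + k) (k - 1)).det * homPoly γ e +
    (toeplitzSub c k (e - d + k - 1)).det * homPoly β d

theorem degree_homPoly [Nontrivial R] {γ : PowerSeries R} (hγ : PowerSeries.coeff 0 γ = 1)
    (m : ℕ) : (homPoly γ m).degree = (m : WithBot ℕ) := by
  refine degree_eq_of_natDegree_le_of_coeff ?_ ?_
  · rw [natDegree_le_iff_coeff_eq_zero]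
    intro i hi
    rw [coeff_homPoly, intCoeff_of_neg _ (by omega)]
  · rw [coeff_homPoly, sub_self, ← Nat.cast_zero, intCoeff_natCast, hγ]
    exact one_ne_zero

/-- One combination has the prescribed cofactor of `homPoly β d`, another that of `homPoly γ e`.
Their difference, after the sign from duality, has degree below `d - k`, so it vanishes; then the
cofactors of `homPoly γ e` agree as well, and the first combination is the stated formula. -/
theorem toeplitzRemainder_spec [IsDomain R] {c c' γ β : PowerSeries R} {e d : ℕ} (hde : d < e)
    (hc0 : PowerSeries.coeff 0 c = 1) (hcc' : c * c' = 1)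
    (hγ0 : PowerSeries.coeff 0 γ = 1) (hβ0 : PowerSeries.coeff 0 β = 1)
    (hcγ : c * γ = β) (hγ : ∀ i, e < i → PowerSeries.coeff i γ = 0)
    (hβ : ∀ i, d < i → PowerSeries.coeff i β = 0)
    (hF : ∀ j, 1 ≤ j → j ≤ d → (toeplitz c j (e - d + j)).det ≠ 0)
    {k : ℕ} (hk1 : 1 ≤ k) (hkd : k ≤ d) :
    (∃ U V : R[X], U.degree < k ∧
      toeplitzRemainder c c' γ β e d k = U * homPoly γ e + V * homPoly β d) ∧
    (toeplitzRemainder c c' γ β e d k).degree = ((d - k : ℕ) : WithBot ℕ) ∧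
    (toeplitzRemainder c c' γ β e d k).coeff (d - k) = (toeplitz c k (e - d + k)).det := by
  have hfdeg : (homPoly β d).degree = (d : WithBot ℕ) := degree_homPoly hβ0 d
  have hex : ∀ j, ∃ U : R[X], 1 ≤ j → j ≤ d → U.degree < j ∧
      ((toeplitzSub c j (e - d + j - 1)).det * homPoly β d + U * homPoly γ e).natDegree ≤ d - j ∧
      ((toeplitzSub c j (e - d + j - 1)).det * homPoly β d + U * homPoly γ e).coeff (d - j) =
        (toeplitz c j (e - d + j)).det := by
    intro j
    by_cases hj : 1 ≤ j ∧ j ≤ d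
    · obtain ⟨U, h1, h2, h3⟩ := exists_cofactor (c := c) (d := d) (N := e - d + j - 1) (k := j)
        (r := d - j) hγ hγ0 (by rwa [hcγ]) (by omega) (by omega)
      rw [hcγ] at h2 h3
      rw [show e - d + j - 1 + 1 = e - d + j by omega] at h3
      exact ⟨U, fun _ _ => ⟨h1, h2, h3⟩⟩
    -- A dummy value, so that the cofactors can be chosen as a function of all `j`.
    · exact ⟨0, fun h h' => absurd ⟨h, h'⟩ hj⟩
  choose U hU using hex
  set S : ℕ → R[X] := fun j =>
    (toeplitzSub c j (e - d + j - 1)).det * homPoly β d + U j * homPoly γ e with hSdef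
  have hS : ∀ j, 1 ≤ j → j ≤ d → (S j).degree = ((d - j : ℕ) : WithBot ℕ) ∧
      ∃ U V : R[X], U.degree < j ∧ S j = U * homPoly γ e + V * homPoly β d := by
    intro j h1 h2
    obtain ⟨a1, a2, a3⟩ := hU j h1 h2
    exact ⟨degree_eq_of_natDegree_le_of_coeff a2 (by rw [a3]; exact hF j h1 h2),
      U j, _, a1, add_comm _ _⟩
  have hc'β : c' * β = γ := by rw [← hcγ, ← mul_assoc, mul_comm c', hcc', one_mul]
  -- The same construction with the two polynomials exchanged and `c` replaced by its inverse; `r =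
  -- d - k` is unchanged.
  obtain ⟨V₀, -, b2, b3⟩ := exists_cofactor (c := c') (γ := β) (d := e) (e := d) (N := k - 1)
    (k := e - d + k) (r := d - k) hβ hβ0 (by rwa [hc'β]) (by omega) (by omega)
  rw [hc'β] at b2 b3
  rw [show k - 1 + 1 = k by omega] at b3
  obtain ⟨a1, a2, a3⟩ := hU k hk1 hkd
  set ε : R := (-1) ^ ((e - d + k) * k) with hε
  set U₀ := (toeplitzSub c' (e - d + k) (k - 1)).det with hU₀
  have hU₀deg : (C ε * U₀).degree < (k : WithBot ℕ) := by
    refine (degree_le_of_natDegree_le ((natDegree_C_mul_le _ _).trans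
      (natDegree_det_toeplitzSub_le _ _ _))).trans_lt ?_
    exact_mod_cast (by omega : k - 1 < k)
  have hcomb : C ε * (U₀ * homPoly γ e + V₀ * homPoly β d) - S k =
      (C ε * U₀ - U k) * homPoly γ e +
        (C ε * V₀ - (toeplitzSub c k (e - d + k - 1)).det) * homPoly β d := by
    simp only [hSdef]
    ring
  have hUdeg : (C ε * U₀ - U k).degree < (k : WithBot ℕ) :=
    (degree_sub_le _ _).trans_lt (max_lt hU₀deg a1)
  have hlt : (C ε * (U₀ * homPoly γ e + V₀ * homPoly β d) - S k).degree <
      ((d - k : ℕ) : WithBot ℕ) := by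
    refine degree_lt_of_natDegree_le_of_coeff ((natDegree_sub_le _ _).trans
      (max_le ((natDegree_C_mul_le _ _).trans b2) a2)) ?_
    rw [coeff_sub, coeff_C_mul, b3, hSdef, a3, det_toeplitz_eq_of_mul_eq_one hc0 hcc', sub_self]
  rw [hcomb] at hlt
  have hz := combination_eq_zero hfdeg hS k hkd _ _ hUdeg hlt
  -- The combination of index `d` is a nonzero constant, as `cofactor_eq_zero` requires.
  obtain ⟨hd0, Ud, Vd, -, hSd⟩ := hS d (hk1.trans hkd) le_rfl
  rw [Nat.sub_self, Nat.cast_zero] at hd0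
  have hUeq := sub_eq_zero.1 (cofactor_eq_zero hfdeg hd0 hSd
    (hUdeg.trans_le (by exact_mod_cast hkd)) hz)
  have hrem : toeplitzRemainder c c' γ β e d k = S k := by
    rw [toeplitzRemainder, neg_one_pow_mul_succ_eq, ← hU₀, hSdef]
    simp only
    rw [← hUeq, hε, add_comm]
    simp
  rw [hrem]
  exact ⟨(hS k hk1 hkd).2, (hS k hk1 hkd).1, a3⟩

end Remainder

/-! ### Generating series of alphabets. -/

section Alphabets

variable {R : Type*} [CommRing R]

/-- The power series `∏ (1 - a z)`. -/
def numSeries (A : Multiset R) : PowerSeries R :=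
  (A.map fun a => (1 - PowerSeries.C a * PowerSeries.X : PowerSeries R)).prod

/-- The power series `∏ 1 / (1 - a z)`. -/
def denSeries (A : Multiset R) : PowerSeries R :=
  (A.map fun a => (PowerSeries.mk fun n => a ^ n : PowerSeries R)).prod

theorem complete_eq_intCoeff (A B : Multiset R) (i : ℤ) :
    complete A B i = intCoeff (numSeries B * denSeries A) i := rfl

theorem one_sub_mul_mk_pow (a : R) :
    (1 - PowerSeries.C a * PowerSeries.X : PowerSeries R) * PowerSeries.mk (fun n => a ^ n) = 1 := by
  ext n
  rw [sub_mul, one_mul, mul_assoc, map_sub, PowerSeries.coeff_C_mul]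
  rcases n with _ | n
  · simp
  · rw [PowerSeries.coeff_succ_X_mul]
    simp [pow_succ', PowerSeries.coeff_one]

theorem numSeries_mul_denSeries (A : Multiset R) : numSeries A * denSeries A = 1 := by
  rw [numSeries, denSeries, ← Multiset.prod_map_mul]
  simp [one_sub_mul_mk_pow]

theorem numSeries_add (A B : Multiset R) : numSeries (A + B) = numSeries A * numSeries B := by
  simp [numSeries]

theorem numSeries_singleton (a : R) :
    numSeries {a} = 1 - PowerSeries.C a * PowerSeries.X := by
  simp [numSeries]

theorem denSeries_singleton (a : R) : denSeries {a} = PowerSeries.mk fun n => a ^ n := by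
  simp [denSeries]

theorem numSeries_zero : numSeries (0 : Multiset R) = 1 := by simp [numSeries]

theorem denSeries_zero : denSeries (0 : Multiset R) = 1 := by simp [denSeries]

theorem map_numSeries {S : Type*} [CommRing S] (φ : R →+* S) (A : Multiset R) :
    (numSeries A).map φ = numSeries (A.map φ) := by
  rw [numSeries, map_multiset_prod, numSeries, Multiset.map_map, Multiset.map_map]
  simp

theorem map_denSeries {S : Type*} [CommRing S] (φ : R →+* S) (A : Multiset R) :
    (denSeries A).map φ = denSeries (A.map φ) := by
  rw [denSeries, map_multiset_prod, denSeries, Multiset.map_map, Multiset.map_map]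
  congr 2
  ext a n
  simp

theorem intCoeff_map {S : Type*} [CommRing S] (φ : R →+* S) (c : PowerSeries R) (i : ℤ) :
    intCoeff (c.map φ) i = φ (intCoeff c i) := by
  unfold intCoeff
  split_ifs <;> simp

theorem coeff_zero_numSeries (A : Multiset R) : PowerSeries.coeff 0 (numSeries A) = 1 := by
  rw [PowerSeries.coeff_zero_eq_constantCoeff_apply, numSeries, map_multiset_prod]
  simp

theorem coeff_zero_denSeries (A : Multiset R) : PowerSeries.coeff 0 (denSeries A) = 1 := by
  rw [PowerSeries.coeff_zero_eq_constantCoeff_apply, denSeries, map_multiset_prod,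
    Multiset.map_map]
  refine Multiset.prod_eq_one fun x hx => ?_
  obtain ⟨a, -, rfl⟩ := Multiset.mem_map.1 hx
  simp [← PowerSeries.coeff_zero_eq_constantCoeff_apply]

theorem coeff_numSeries_of_card_lt (A : Multiset R) :
    ∀ i, A.card < i → PowerSeries.coeff i (numSeries A) = 0 := by
  induction A using Multiset.induction_on with
  | empty =>
    intro i hi
    rw [numSeries_zero, PowerSeries.coeff_one, if_neg (by simp at hi; omega)]
  | cons a A ih =>
    intro i hi
    rw [Multiset.card_cons] at hi
    obtain ⟨i, rfl⟩ := Nat.exists_eq_succ_of_ne_zero (show i ≠ 0 by omega)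
    rw [← Multiset.singleton_add, numSeries_add, numSeries_singleton, sub_mul, one_mul, mul_assoc,
      map_sub, PowerSeries.coeff_C_mul, Nat.succ_eq_add_one, PowerSeries.coeff_succ_X_mul,
      ih _ (by omega), ih _ (by omega), mul_zero, sub_zero]

theorem complete_singleton_X (A : Multiset R) (m : ℕ) :
    complete {X} (A.map C) (m : ℤ) = homPoly (numSeries A) m := by
  rw [complete_eq_intCoeff, intCoeff_natCast, PowerSeries.coeff_mul, homPoly,
    ← map_numSeries, denSeries_singleton]
  simp

theorem intCoeff_one_sub_C_mul_X_mul (a : R) (c : PowerSeries R) (i : ℤ) :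
    intCoeff ((1 - PowerSeries.C a * PowerSeries.X) * c) i =
      intCoeff c i - a * intCoeff c (i - 1) := by
  rcases lt_or_ge i 0 with hi | hi
  · simp [intCoeff_of_neg _ hi, intCoeff_of_neg c (show i - 1 < 0 by omega)]
  · lift i to ℕ using hi
    rw [intCoeff_natCast, intCoeff_natCast, show (i : ℤ) - 1 = (i : ℤ) - ((1 : ℕ) : ℤ) by simp,
      intCoeff_natCast_sub, sub_mul, one_mul, mul_assoc, map_sub, PowerSeries.coeff_C_mul, pow_one]

theorem schur_add_X (A B : Multiset R) (p n : ℕ) :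
    schur (fun _ : Fin n => p) (A.map C) (B.map C + {(X : R[X])}) =
      (toeplitzSub (numSeries B * denSeries A) p n).det := by
  rw [schur, toeplitzSub]
  congr 1
  ext1 h j
  simp only [Matrix.of_apply]
  rw [complete_eq_intCoeff, add_comm, numSeries_add, numSeries_singleton, mul_assoc,
    intCoeff_one_sub_C_mul_X_mul, ← map_numSeries, ← map_denSeries, ← map_mul, intCoeff_map,
    intCoeff_map]

end Alphabets

theorem genericRemainder_eq (F : Type*) [Field F] (e d k : ℕ) :
    genericRemainder F e d k =
      toeplitzRemainder (numSeries (alphB F e d) * denSeries (alphA F e d))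
        (numSeries (alphA F e d) * denSeries (alphB F e d)) (numSeries (alphA F e d))
        (numSeries (alphB F e d)) e d k := by
  rw [genericRemainder, toeplitzRemainder, alphAT, alphBT, schur_add_X, schur_add_X, genericA,
    genericB, alphAT, alphBT, complete_singleton_X, complete_singleton_X]

/-! ### Algebraic independence of the coefficients of one alphabet. -/

section Generic

variable {R : Type*} [CommRing R]

theorem coeff_eq_of_mul_eq_one {a b a' b' : PowerSeries R} (h : a * b = 1) (h' : a' * b' = 1)
    {n : ℕ} (hn : ∀ i < n, PowerSeries.coeff i a = PowerSeries.coeff i a') :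
    ∀ i < n, PowerSeries.coeff i b = PowerSeries.coeff i b' := by
  have h1 : PowerSeries.X ^ n ∣ a - a' := by
    rw [PowerSeries.X_pow_dvd_iff]
    intro m hm
    rw [map_sub, hn m hm, sub_self]
  have h2 : b' - b = (a - a') * (b * b') := by
    linear_combination (-b') * h + b * h'
  have h3 : PowerSeries.X ^ n ∣ b' - b := h2 ▸ h1.mul_right _
  intro i hi
  have := PowerSeries.X_pow_dvd_iff.1 h3 i hi
  rw [map_sub] at this
  exact (sub_eq_zero.1 this).symm

theorem coeff_numSeries_eq_esymm (A : Multiset R) :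
    ∀ i, PowerSeries.coeff i (numSeries A) = (-1) ^ i * A.esymm i := by
  induction A using Multiset.induction_on with
  | empty =>
    intro i
    rw [numSeries_zero, PowerSeries.coeff_one]
    rcases i with _ | i
    · simp [Multiset.esymm]
    · simp [Multiset.esymm, Multiset.powersetCard_zero_right]
  | cons a A ih =>
    intro i
    rw [← Multiset.singleton_add, numSeries_add, numSeries_singleton, sub_mul, one_mul, mul_assoc,
      map_sub, PowerSeries.coeff_C_mul, Multiset.singleton_add]
    rcases i with _ | i
    · simp [ih, Multiset.esymm]
    · rw [PowerSeries.coeff_succ_X_mul, ih, ih]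
      simp only [Multiset.esymm, Multiset.powersetCard_cons, Multiset.map_add, Multiset.sum_add,
        Multiset.map_map, Function.comp_def, Multiset.prod_cons, Multiset.sum_map_mul_left]
      ring

/-- The alphabet of all the indeterminates. -/
def genericAlphabet (R : Type*) [CommRing R] (n : ℕ) : Multiset (MvPolynomial (Fin n) R) :=
  (Finset.univ : Finset (Fin n)).val.map MvPolynomial.X

/-- The power series `1 + x₁ z + ⋯ + xₙ zⁿ`. -/
def genericSeries (R : Type*) [CommRing R] (n : ℕ) : PowerSeries (MvPolynomial (Fin n) R) :=
  PowerSeries.mk fun i => if i = 0 then 1 else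
    if h : i - 1 < n then MvPolynomial.X ⟨i - 1, h⟩ else 0

theorem coeff_zero_genericSeries (n : ℕ) : PowerSeries.coeff 0 (genericSeries R n) = 1 := by
  simp [genericSeries]

theorem coeff_genericSeries_of_lt {n i : ℕ} (h : n < i) :
    PowerSeries.coeff i (genericSeries R n) = 0 := by
  rw [genericSeries, PowerSeries.coeff_mk, if_neg (by omega), dif_neg (by omega)]

theorem coeff_succ_genericSeries {n : ℕ} (i : Fin n) :
    PowerSeries.coeff ((i : ℕ) + 1) (genericSeries R n) = MvPolynomial.X i := by
  simp [genericSeries]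

theorem coeff_map_genericSeries {S : Type*} [CommRing S] {n : ℕ}
    (φ : MvPolynomial (Fin n) R →+* S) {c : PowerSeries S} (hc : PowerSeries.coeff 0 c = 1)
    (h : ∀ i : Fin n, φ (MvPolynomial.X i) = PowerSeries.coeff ((i : ℕ) + 1) c) :
    ∀ i < n + 1, PowerSeries.coeff i ((genericSeries R n).map φ) = PowerSeries.coeff i c := by
  intro i hi
  rw [PowerSeries.coeff_map]
  rcases i with _ | i
  · rw [coeff_zero_genericSeries, map_one, hc]
  · rw [show i + 1 = ((⟨i, by omega⟩ : Fin n) : ℕ) + 1 from rfl, coeff_succ_genericSeries, h]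

/-- The inverse of `genericSeries`. -/
def genericInverse (R : Type*) [CommRing R] (n : ℕ) : PowerSeries (MvPolynomial (Fin n) R) :=
  PowerSeries.invOfUnit (genericSeries R n) 1

theorem genericSeries_mul_genericInverse (n : ℕ) :
    genericSeries R n * genericInverse R n = 1 := by
  refine PowerSeries.mul_invOfUnit _ _ ?_
  rw [← PowerSeries.coeff_zero_eq_constantCoeff_apply, coeff_zero_genericSeries, Units.val_one]

theorem coeff_zero_genericInverse (n : ℕ) : PowerSeries.coeff 0 (genericInverse R n) = 1 := by
  rw [PowerSeries.coeff_zero_eq_constantCoeff_apply, genericInverse,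
    PowerSeries.constantCoeff_invOfUnit]
  simp

theorem coeff_map_genericInverse {S : Type*} [CommRing S] {n : ℕ}
    (φ : MvPolynomial (Fin n) R →+* S) {c c' : PowerSeries S} (hc : PowerSeries.coeff 0 c = 1)
    (hcc' : c * c' = 1)
    (h : ∀ i : Fin n, φ (MvPolynomial.X i) = PowerSeries.coeff ((i : ℕ) + 1) c) :
    ∀ i < n + 1, PowerSeries.coeff i ((genericInverse R n).map φ) = PowerSeries.coeff i c' := by
  refine coeff_eq_of_mul_eq_one (a := (genericSeries R n).map φ) ?_ hcc'
    (coeff_map_genericSeries φ hc h)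
  rw [← map_mul, genericSeries_mul_genericInverse, map_one]

/-- Substitution of the coefficients of a power series for the indeterminates. -/
def substCoeff {n : ℕ} (c : PowerSeries (MvPolynomial (Fin n) R)) :
    MvPolynomial (Fin n) R →ₐ[R] MvPolynomial (Fin n) R :=
  MvPolynomial.aeval fun i : Fin n => PowerSeries.coeff ((i : ℕ) + 1) c

theorem substCoeff_X {n : ℕ} (c : PowerSeries (MvPolynomial (Fin n) R)) (i : Fin n) :
    substCoeff c (MvPolynomial.X i) = PowerSeries.coeff ((i : ℕ) + 1) c := by
  simp [substCoeff]

/-- The coefficients are elementary symmetric polynomials up to sign. The sign change is an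
involution, and the rest is the fundamental theorem on symmetric polynomials. -/
theorem substCoeff_numSeries_injective (n : ℕ) :
    Function.Injective (substCoeff (numSeries (genericAlphabet R n))) := by
  set s : MvPolynomial (Fin n) R →ₐ[R] MvPolynomial (Fin n) R :=
    MvPolynomial.aeval fun i : Fin n => (-1) ^ ((i : ℕ) + 1) * MvPolynomial.X i with hs
  have hss : ∀ p, s (s p) = p := by
    intro p
    have : s.comp s = AlgHom.id R _ := by
      ext1 i
      simp only [AlgHom.comp_apply, hs, MvPolynomial.aeval_X, map_mul, map_pow, map_neg, map_one,
        AlgHom.id_apply]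
      rw [← mul_assoc, ← mul_pow]
      simp
    exact congrArg (fun f => f p) this
  have hcomp : ∀ p, substCoeff (numSeries (genericAlphabet R n)) p =
      ((MvPolynomial.esymmAlgHom (Fin n) R n) (s p)).val := by
    intro p
    have : substCoeff (numSeries (genericAlphabet R n)) =
        (MvPolynomial.aeval fun i : Fin n => MvPolynomial.esymm (Fin n) R (i + 1)).comp s := by
      ext1 i
      rw [substCoeff_X, coeff_numSeries_eq_esymm]
      simp [hs, MvPolynomial.esymm_eq_multiset_esymm, genericAlphabet]
    rw [this, MvPolynomial.esymmAlgHom_apply]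
    rfl
  intro p q hpq
  rw [hcomp, hcomp] at hpq
  have h1 := MvPolynomial.esymmAlgHom_fin_injective R (le_refl n) (Subtype.ext hpq)
  rw [← hss p, h1, hss]

/-- Expressing the coefficients of a series through those of its inverse is an involution on
polynomials, and it exchanges this case with `substCoeff_numSeries_injective`. -/
theorem substCoeff_denSeries_injective (n : ℕ) :
    Function.Injective (substCoeff (denSeries (genericAlphabet R n))) := by
  have hθ : ∀ p, substCoeff (genericInverse R n) (substCoeff (genericInverse R n) p) = p := by
    intro p
    have : (substCoeff (genericInverse R n)).comp (substCoeff (genericInverse R n)) =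
        AlgHom.id R _ := by
      ext1 i
      have h := coeff_map_genericInverse (substCoeff (genericInverse R n)).toRingHom
        (coeff_zero_genericInverse n) ((mul_comm _ _).trans (genericSeries_mul_genericInverse n))
        (fun i => substCoeff_X _ i) ((i : ℕ) + 1) (by omega)
      rw [coeff_succ_genericSeries, PowerSeries.coeff_map] at h
      rw [AlgHom.comp_apply, substCoeff_X]
      exact h
    exact congrArg (fun f => f p) this
  have hcomp : ∀ p, substCoeff (denSeries (genericAlphabet R n)) p =
      substCoeff (numSeries (genericAlphabet R n)) (substCoeff (genericInverse R n) p) := by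
    intro p
    have : substCoeff (denSeries (genericAlphabet R n)) =
        (substCoeff (numSeries (genericAlphabet R n))).comp (substCoeff (genericInverse R n)) := by
      ext1 i
      have h := coeff_map_genericInverse (substCoeff (numSeries (genericAlphabet R n))).toRingHom
        (coeff_zero_numSeries _) (numSeries_mul_denSeries _)
        (fun i => substCoeff_X _ i) ((i : ℕ) + 1) (by omega)
      rw [PowerSeries.coeff_map] at h
      rw [AlgHom.comp_apply, substCoeff_X, substCoeff_X]
      exact h.symm
    rw [this]
    rfl
  intro p q hpq
  rw [hcomp, hcomp] at hpq
  rw [← hθ p, substCoeff_numSeries_injective n hpq, hθ]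

/-- The series `∏ 1 / (1 - a z)` written in terms of its first coefficients. -/
def completeSeries (R : Type*) [CommRing R] (n : ℕ) : PowerSeries (MvPolynomial (Fin n) R) :=
  PowerSeries.invOfUnit (PowerSeries.trunc (n + 1) (genericInverse R n) : PowerSeries _) 1

theorem trunc_mul_completeSeries (n : ℕ) :
    (PowerSeries.trunc (n + 1) (genericInverse R n) : PowerSeries _) * completeSeries R n = 1 := by
  refine PowerSeries.mul_invOfUnit _ _ ?_
  rw [← PowerSeries.coeff_zero_eq_constantCoeff_apply, Polynomial.coeff_coe, PowerSeries.coeff_trunc,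
    if_pos (by omega), coeff_zero_genericInverse, Units.val_one]

theorem coeff_zero_completeSeries (n : ℕ) : PowerSeries.coeff 0 (completeSeries R n) = 1 := by
  rw [PowerSeries.coeff_zero_eq_constantCoeff_apply, completeSeries,
    PowerSeries.constantCoeff_invOfUnit]
  simp

/-- The inverse of `denSeries A` is a polynomial of degree at most `n`, so it is determined by the
first `n` coefficients of `denSeries A`; inverting it back recovers all later ones. -/
theorem map_completeSeries {S : Type*} [CommRing S] {n : ℕ} (φ : MvPolynomial (Fin n) R →+* S)
    {A : Multiset S} (hA : A.card ≤ n)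
    (h : ∀ i : Fin n, φ (MvPolynomial.X i) = PowerSeries.coeff ((i : ℕ) + 1) (denSeries A)) :
    (completeSeries R n).map φ = denSeries A := by
  have h1 : PowerSeries.map φ (PowerSeries.trunc (n + 1) (genericInverse R n) : PowerSeries _) =
      numSeries A := by
    ext i
    rw [PowerSeries.coeff_map, Polynomial.coeff_coe, PowerSeries.coeff_trunc]
    split_ifs with hi
    · rw [← PowerSeries.coeff_map]
      exact coeff_map_genericInverse φ (coeff_zero_denSeries A)
        ((mul_comm _ _).trans (numSeries_mul_denSeries A)) h i hi
    · rw [map_zero, coeff_numSeries_of_card_lt A i (by omega)]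
  have h2 := congrArg (PowerSeries.map φ) (trunc_mul_completeSeries (R := R) n)
  rw [map_mul, h1, map_one] at h2
  calc (completeSeries R n).map φ
      = numSeries A * denSeries A * (completeSeries R n).map φ := by
        rw [numSeries_mul_denSeries, one_mul]
    _ = denSeries A * (numSeries A * (completeSeries R n).map φ) := by ring
    _ = denSeries A := by rw [h2, mul_one]

end Generic

/-! ### Joint independence of `𝐒` and `𝐓`. -/

section EvalTS

variable (F : Type*) [Field F] (e d : ℕ)

/-- `evalTS` as a ring homomorphism. -/
def evalTSHom : MvPolynomial (Fin d) (MvPolynomial (Fin e) F) →+* GenericRing F e d :=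
  MvPolynomial.eval₂Hom
    (MvPolynomial.aeval (R := F) fun i : Fin e =>
      complete (alphA F e d) 0 (((i : ℕ) : ℤ) + 1)).toRingHom
    (fun i : Fin d => complete 0 (alphB F e d) (((i : ℕ) : ℤ) + 1))

theorem evalTS_eq (P : MvPolynomial (Fin d) (MvPolynomial (Fin e) F)) :
    evalTS F e d P = evalTSHom F e d P := rfl

theorem complete_zero_right {R : Type*} [CommRing R] (A : Multiset R) (i : ℕ) :
    complete A 0 ((i : ℤ) + 1) = PowerSeries.coeff (i + 1) (denSeries A) := by
  rw [complete_eq_intCoeff, ← Nat.cast_succ, intCoeff_natCast, numSeries_zero, one_mul]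

theorem complete_zero_left {R : Type*} [CommRing R] (B : Multiset R) (i : ℕ) :
    complete 0 B ((i : ℤ) + 1) = PowerSeries.coeff (i + 1) (numSeries B) := by
  rw [complete_eq_intCoeff, ← Nat.cast_succ, intCoeff_natCast, denSeries_zero, mul_one]

theorem evalTSHom_X (i : Fin d) : evalTSHom F e d (MvPolynomial.X i) =
    PowerSeries.coeff ((i : ℕ) + 1) (numSeries (alphB F e d)) := by
  simp [evalTSHom, complete_zero_left]

theorem evalTSHom_C_X (i : Fin e) : evalTSHom F e d (MvPolynomial.C (MvPolynomial.X i)) =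
    PowerSeries.coeff ((i : ℕ) + 1) (denSeries (alphA F e d)) := by
  simp [evalTSHom, complete_zero_right]

theorem card_alphA : (alphA F e d).card = e := by simp [alphA]

theorem card_alphB : (alphB F e d).card = d := by simp [alphB]

/-- Polynomials in `𝔹` over `F[𝔸]`, seen as polynomials in `𝔸` and `𝔹`. -/
def flattenEquiv : MvPolynomial (Fin d) (MvPolynomial (Fin e) F) ≃ₐ[F] GenericRing F e d :=
  (MvPolynomial.sumAlgEquiv F (Fin d) (Fin e)).symm.trans
    (MvPolynomial.renameEquiv F (Equiv.sumComm _ _))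

theorem flattenEquiv_X (i : Fin d) :
    flattenEquiv F e d (MvPolynomial.X i) = MvPolynomial.X (Sum.inr i) := by
  simp [flattenEquiv]

theorem flattenEquiv_C_X (i : Fin e) :
    flattenEquiv F e d (MvPolynomial.C (MvPolynomial.X i)) = MvPolynomial.X (Sum.inl i) := by
  simp [flattenEquiv]

/-- The evaluation factors as the substitution for `𝐓` on coefficients, then the substitution for
`𝐒` over `F[𝔸]`, then an isomorphism; each factor is injective. -/
theorem evalTSHom_injective : Function.Injective (evalTSHom F e d) := by
  have hcomp : evalTSHom F e d =
      ((flattenEquiv F e d).toRingEquiv.toRingHom.comp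
        (substCoeff (numSeries (genericAlphabet (MvPolynomial (Fin e) F) d))).toRingHom).comp
        (MvPolynomial.map (substCoeff (denSeries (genericAlphabet F e))).toRingHom) := by
    refine MvPolynomial.ringHom_ext' (MvPolynomial.ringHom_ext' ?_ ?_) ?_
    · refine RingHom.ext fun a => ?_
      simp [evalTSHom, flattenEquiv]
    · intro i
      have h1 : (genericAlphabet F e).map
          ((flattenEquiv F e d).toRingEquiv.toRingHom.comp MvPolynomial.C) = alphA F e d := by
        rw [genericAlphabet, alphA, Multiset.map_map]
        exact Multiset.map_congr rfl fun i _ => flattenEquiv_C_X F e d i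
      simp only [RingHom.comp_apply, evalTSHom_C_X, MvPolynomial.map_C]
      rw [← h1, ← map_denSeries, PowerSeries.coeff_map]
      simp [substCoeff]
    · intro i
      have h1 : (genericAlphabet (MvPolynomial (Fin e) F) d).map
          ((flattenEquiv F e d).toRingEquiv.toRingHom) = alphB F e d := by
        rw [genericAlphabet, alphB, Multiset.map_map]
        exact Multiset.map_congr rfl fun i _ => flattenEquiv_X F e d i
      rw [evalTSHom_X, ← h1, ← map_numSeries, PowerSeries.coeff_map]
      simp [substCoeff]
  rw [hcomp]
  exact ((flattenEquiv F e d).injective.comp (substCoeff_numSeries_injective d)).comp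
    (MvPolynomial.map_injective _ (substCoeff_denSeries_injective e))

end EvalTS

/-! ### The leading coefficient as a polynomial in `𝐒` over `F[𝐓]`. -/

section LeadingPolynomial

variable (R : Type*) [CommRing R] (e d : ℕ)

/-- The series `S(𝔸 - 𝔹)` written in terms of the coefficients of `S(𝔸)` and `S(-𝔹)`. -/
def differenceSeries : PowerSeries (MvPolynomial (Fin d) (MvPolynomial (Fin e) R)) :=
  genericSeries (MvPolynomial (Fin e) R) d * (completeSeries R e).map MvPolynomial.C

/-- The rectangular Schur function `S_{k^n}(𝔸 - 𝔹)` written in terms of the coefficients of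
`S(𝔸)` and `S(-𝔹)`. -/
def leadingPoly (k n : ℕ) : MvPolynomial (Fin d) (MvPolynomial (Fin e) R) :=
  (toeplitz (differenceSeries R e d) k n).det

variable {R} {e d}

theorem map_det_toeplitz {S T : Type*} [CommRing S] [CommRing T] (φ : S →+* T) (c : PowerSeries S)
    (k n : ℕ) : φ (toeplitz c k n).det = (toeplitz (c.map φ) k n).det := by
  rw [RingHom.map_det]
  congr 1
  ext1 i j
  simp [toeplitz, intCoeff_map]

/-- Each summand is one coefficient of `genericSeries`, namely `0`, `1` or a variable, times a
constant from `F[𝐓]`. -/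
theorem totalDegree_differenceSeries_le (m : ℤ) :
    (intCoeff (differenceSeries R e d) m).totalDegree ≤ 1 := by
  rcases lt_or_ge m 0 with hm | hm
  · simp [intCoeff_of_neg _ hm]
  · lift m to ℕ using hm
    rw [intCoeff_natCast, differenceSeries, PowerSeries.coeff_mul]
    refine MvPolynomial.totalDegree_finsetSum_le fun p _ => ?_
    refine (MvPolynomial.totalDegree_mul _ _).trans ?_
    rw [PowerSeries.coeff_map, MvPolynomial.totalDegree_C, add_zero, genericSeries,
      PowerSeries.coeff_mk]
    split_ifs
    · simp
    · rw [MvPolynomial.X]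
      exact (MvPolynomial.totalDegree_monomial_le _ _).trans (by simp)
    · simp

theorem totalDegree_leadingPoly_le (k n : ℕ) : (leadingPoly R e d k n).totalDegree ≤ n := by
  rw [leadingPoly, Matrix.det_apply]
  refine MvPolynomial.totalDegree_finsetSum_le fun σ _ => ?_
  refine (MvPolynomial.totalDegree_smul_le _ _).trans ?_
  refine (MvPolynomial.totalDegree_finsetProd _ _).trans ?_
  calc ∑ i : Fin n, (toeplitz (differenceSeries R e d) k n (σ i) i).totalDegree
      ≤ ∑ _i : Fin n, 1 := Finset.sum_le_sum fun i _ => totalDegree_differenceSeries_le _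
    _ = n := by simp

/-- `inVariable` as a ring homomorphism. -/
def inVariableHom {σ : Type*} [DecidableEq σ] (i : σ) :
    MvPolynomial σ R →+* (MvPolynomial σ R)[X] :=
  MvPolynomial.eval₂Hom ((C : MvPolynomial σ R →+* (MvPolynomial σ R)[X]).comp MvPolynomial.C)
    (fun j => if j = i then X else C (MvPolynomial.X j))

theorem inVariable_eq {σ : Type*} [DecidableEq σ] (i : σ) (P : MvPolynomial σ R) :
    inVariable i P = inVariableHom i P := rfl

theorem natDegree_inVariable_le {σ : Type*} [DecidableEq σ] (i : σ) (P : MvPolynomial σ R) :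
    (inVariable i P).natDegree ≤ P.totalDegree := by
  rw [inVariable, MvPolynomial.eval₂_eq]
  refine natDegree_sum_le_of_forall_le _ _ fun m hm => ?_
  rw [RingHom.comp_apply]
  refine (natDegree_C_mul_le _ _).trans ((natDegree_prod_le _ _).trans ?_)
  refine le_trans ?_ (MvPolynomial.le_totalDegree hm)
  refine Finset.sum_le_sum fun j _ => natDegree_pow_le.trans ?_
  split_ifs
  · exact (Nat.mul_le_mul_left _ natDegree_X_le).trans (by simp)
  · simp

theorem det_toeplitz_zero {c : PowerSeries R} (hc : PowerSeries.coeff 0 c = 1) (n : ℕ) :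
    (toeplitz c 0 n).det = 1 := by
  rw [Matrix.det_of_isUpperTriangular]
  · exact Finset.prod_eq_one fun i _ => by simp [toeplitz, intCoeff, hc]
  · intro i j hij
    simp only [id] at hij
    have : (j : ℕ) < i := hij
    exact intCoeff_of_neg _ (by omega)

theorem map_inVariableHom_differenceSeries (i : Fin d) :
    (differenceSeries R e d).map (inVariableHom i) =
      ((genericSeries (MvPolynomial (Fin e) R) d -
        PowerSeries.C (MvPolynomial.X i) * PowerSeries.X ^ ((i : ℕ) + 1)) *
          (completeSeries R e).map MvPolynomial.C).map C +
      PowerSeries.C X * (PowerSeries.X ^ ((i : ℕ) + 1) *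
        ((completeSeries R e).map MvPolynomial.C).map C) := by
  have h1 : (genericSeries (MvPolynomial (Fin e) R) d).map (inVariableHom i) =
      (genericSeries (MvPolynomial (Fin e) R) d -
        PowerSeries.C (MvPolynomial.X i) * PowerSeries.X ^ ((i : ℕ) + 1)).map C +
      PowerSeries.C X * PowerSeries.X ^ ((i : ℕ) + 1) := by
    ext1 m
    simp only [PowerSeries.coeff_map, map_add, map_sub, PowerSeries.coeff_C_mul,
      PowerSeries.coeff_X_pow, genericSeries, PowerSeries.coeff_mk]
    by_cases h0 : m = 0
    · subst h0; simp
    · by_cases hm : m - 1 < d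
      · rw [if_neg h0, dif_pos hm]
        by_cases hi : m = i + 1
        · have : (⟨m - 1, hm⟩ : Fin d) = i := by ext; simp [hi]
          rw [this, if_pos hi]
          simp [inVariableHom, hi]
        · have : (⟨m - 1, hm⟩ : Fin d) ≠ i := by
            intro h; apply hi; rw [← h]; simp; omega
          rw [if_neg hi]
          simp [inVariableHom, this, hi]
      · rw [if_neg h0, dif_neg hm, if_neg (by omega)]
        simp [show m ≠ i + 1 by omega]
  have h2 : ((completeSeries R e).map MvPolynomial.C).map
      (inVariableHom (R := MvPolynomial (Fin e) R) i) =
      ((completeSeries R e).map MvPolynomial.C).map C := by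
    ext1 m
    simp [inVariableHom]
  rw [differenceSeries, map_mul, h1, h2, map_mul]
  ring

theorem intCoeff_add (c c' : PowerSeries R) (m : ℤ) :
    intCoeff (c + c') m = intCoeff c m + intCoeff c' m := by
  unfold intCoeff
  split_ifs <;> simp

theorem intCoeff_C_mul (a : R) (c : PowerSeries R) (m : ℤ) :
    intCoeff (PowerSeries.C a * c) m = a * intCoeff c m := by
  unfold intCoeff
  split_ifs <;> simp

theorem intCoeff_X_pow_mul (c : PowerSeries R) (k : ℕ) (m : ℤ) :
    intCoeff (PowerSeries.X ^ k * c) m = intCoeff c (m - k) := by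
  rcases lt_or_ge m 0 with hm | hm
  · rw [intCoeff_of_neg _ hm, intCoeff_of_neg _ (by omega)]
  · lift m to ℕ using hm
    rw [intCoeff_natCast, intCoeff_natCast_sub]

theorem inVariable_leadingPoly_eq (i : Fin d) (n : ℕ) :
    inVariable i (leadingPoly R e d ((i : ℕ) + 1) n) =
      (((X : (MvPolynomial (Fin d) (MvPolynomial (Fin e) R))[X]) •
        (toeplitz ((completeSeries R e).map
          (MvPolynomial.C (σ := Fin d))) 0 n).map C) +
        (toeplitz ((genericSeries (MvPolynomial (Fin e) R) d -
        PowerSeries.C (MvPolynomial.X i) * PowerSeries.X ^ ((i : ℕ) + 1)) *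
          (completeSeries R e).map MvPolynomial.C) ((i : ℕ) + 1) n).map C).det := by
  rw [inVariable_eq, leadingPoly, map_det_toeplitz, map_inVariableHom_differenceSeries]
  congr 1
  ext1 h j
  simp only [toeplitz, Matrix.of_apply, Matrix.add_apply, Matrix.smul_apply, Matrix.map_apply,
    intCoeff_add, intCoeff_C_mul, intCoeff_X_pow_mul, intCoeff_map, smul_eq_mul]
  rw [add_comm]
  congr 4
  push_cast
  ring_nf

/-- The variable of index `i` carries `z ^ (i + 1)`, which cancels the offset `i + 1` of the
Toeplitz matrix. The matrix is thus `X` times a unitriangular one plus a matrix free of `X`. -/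
theorem coeff_inVariable_leadingPoly (i : Fin d) (n : ℕ) :
    (inVariable i (leadingPoly R e d ((i : ℕ) + 1) n)).coeff n = 1 := by
  have h := Polynomial.coeff_det_X_add_C_card
    (toeplitz ((completeSeries R e).map (MvPolynomial.C (σ := Fin d))) 0 n)
    (toeplitz ((genericSeries (MvPolynomial (Fin e) R) d -
        PowerSeries.C (MvPolynomial.X i) * PowerSeries.X ^ ((i : ℕ) + 1)) *
          (completeSeries R e).map MvPolynomial.C) ((i : ℕ) + 1) n)
  rw [Fintype.card_fin] at h
  rw [inVariable_leadingPoly_eq, h, det_toeplitz_zero]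
  rw [PowerSeries.coeff_map, coeff_zero_completeSeries, map_one]

theorem natDegree_inVariable_leadingPoly_le (i : Fin d) (n : ℕ) :
    (inVariable i (leadingPoly R e d ((i : ℕ) + 1) n)).natDegree ≤ n :=
  (natDegree_inVariable_le _ _).trans (totalDegree_leadingPoly_le _ _)

end LeadingPolynomial

theorem evalTSHom_leadingPoly (F : Type*) [Field F] (e d k n : ℕ) :
    evalTSHom F e d (leadingPoly F e d k n) =
      (toeplitz (numSeries (alphB F e d) * denSeries (alphA F e d)) k n).det := by
  rw [leadingPoly, map_det_toeplitz, differenceSeries, map_mul]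
  congr 3
  · ext1 i
    by_cases hi : i < d + 1
    · exact coeff_map_genericSeries _ (coeff_zero_numSeries _) (evalTSHom_X F e d) i hi
    · rw [PowerSeries.coeff_map, coeff_genericSeries_of_lt (by omega), map_zero,
        coeff_numSeries_of_card_lt _ i (by rw [card_alphB]; omega)]
  · have := map_completeSeries ((evalTSHom F e d).comp MvPolynomial.C) (card_alphA F e d).le
      (evalTSHom_C_X F e d)
    rw [← this]
    ext1 i
    simp

/-- By independence it suffices that `leadingPoly` is nonzero, and it has a coefficient equal to
`1`. -/
theorem det_toeplitz_ne_zero (F : Type*) [Field F] (e d n : ℕ) {k : ℕ} (hk1 : 1 ≤ k)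
    (hkd : k ≤ d) :
    (toeplitz (numSeries (alphB F e d) * denSeries (alphA F e d)) k n).det ≠ 0 := by
  rw [← evalTSHom_leadingPoly, map_ne_zero_iff _ (evalTSHom_injective F e d)]
  intro h0
  have h := coeff_inVariable_leadingPoly (R := F) (e := e) (⟨k - 1, by omega⟩ : Fin d) n
  simp only [show k - 1 + 1 = k by omega, h0] at h
  simp [inVariable_eq] at h

end

/-! ### The theorem on generic remainders. -/

theorem mainTheorem3 (F : Type*) [Field F] [Finite F] (e d k : ℕ) (hde : d < e)
    (hk1 : 1 ≤ k) (hkd : k ≤ d) :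
    -- `𝓡_k` is, up to a nonzero factor, the `k`-th remainder of the Euclidean algorithm
    -- over the field of fractions, and it has degree `d - k` in `T`
    (∃ c : FractionRing (GenericRing F e d), c ≠ 0 ∧
      (genericRemainder F e d k).map
          (algebraMap (GenericRing F e d) (FractionRing (GenericRing F e d))) =
        C c * euclidRem
          ((genericA F e d).map
            (algebraMap (GenericRing F e d) (FractionRing (GenericRing F e d))))
          ((genericB F e d).map
            (algebraMap (GenericRing F e d) (FractionRing (GenericRing F e d)))) k) ∧
    (genericRemainder F e d k).natDegree = d - k ∧
    -- its leading coefficient is nonzero, and is in a unique way a polynomial in `𝐒` over `F[𝐓]`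
    (genericRemainder F e d k).leadingCoeff ≠ 0 ∧
    ∃ P : MvPolynomial (Fin d) (MvPolynomial (Fin e) F),
      (∀ Q : MvPolynomial (Fin d) (MvPolynomial (Fin e) F),
        evalTS F e d Q = (genericRemainder F e d k).leadingCoeff ↔ Q = P) ∧
      P ≠ 0 ∧
      P.totalDegree = e - d + k ∧
      (inVariable (⟨k - 1, by omega⟩ : Fin d) P).Monic ∧
      (inVariable (⟨k - 1, by omega⟩ : Fin d) P).natDegree = e - d + k := by
  have spec : ∀ j, 1 ≤ j → j ≤ d →
      (∃ U V : (GenericRing F e d)[X], U.degree < j ∧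
        genericRemainder F e d j = U * genericA F e d + V * genericB F e d) ∧
      (genericRemainder F e d j).degree = ((d - j : ℕ) : WithBot ℕ) ∧
      (genericRemainder F e d j).coeff (d - j) =
        (toeplitz (numSeries (alphB F e d) * denSeries (alphA F e d)) j (e - d + j)).det := by
    intro j hj1 hjd
    rw [genericRemainder_eq, genericA, genericB, alphAT, alphBT, complete_singleton_X,
      complete_singleton_X]
    have hA := numSeries_mul_denSeries (alphA F e d)
    have hB := numSeries_mul_denSeries (alphB F e d)
    refine toeplitzRemainder_spec hde ?_ ?_ (coeff_zero_numSeries _) (coeff_zero_numSeries _) ?_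
      (fun i hi => coeff_numSeries_of_card_lt _ i (by rwa [card_alphA]))
      (fun i hi => coeff_numSeries_of_card_lt _ i (by rwa [card_alphB]))
      (fun i h1 h2 => det_toeplitz_ne_zero F e d _ h1 h2) hj1 hjd
    · simp [PowerSeries.coeff_mul, coeff_zero_numSeries, coeff_zero_denSeries]
    · linear_combination (numSeries (alphB F e d) * denSeries (alphB F e d)) * hA + hB
    · linear_combination numSeries (alphB F e d) * hA
  obtain ⟨-, hdeg, hcoeff⟩ := spec k hk1 hkd
  have hnat : (genericRemainder F e d k).natDegree = d - k := natDegree_eq_of_degree_eq_some hdeg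
  have hlead : (genericRemainder F e d k).leadingCoeff =
      evalTSHom F e d (leadingPoly F e d k (e - d + k)) := by
    rw [leadingCoeff, hnat, hcoeff, evalTSHom_leadingPoly]
  have hcoeffP := coeff_inVariable_leadingPoly (R := F) (e := e) (⟨k - 1, by omega⟩ : Fin d)
    (e - d + k)
  have hdegP := natDegree_inVariable_leadingPoly_le (R := F) (e := e)
    (⟨k - 1, by omega⟩ : Fin d) (e - d + k)
  simp only [show k - 1 + 1 = k by omega] at hcoeffP hdegP
  have hnatP : (inVariable (⟨k - 1, by omega⟩ : Fin d)
      (leadingPoly F e d k (e - d + k))).natDegree = e - d + k :=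
    le_antisymm hdegP (le_natDegree_of_ne_zero (by rw [hcoeffP]; exact one_ne_zero))
  refine ⟨?_, hnat, ?_, leadingPoly F e d k (e - d + k), ?_, ?_, ?_, ?_, hnatP⟩
  · have hinj := IsFractionRing.injective (GenericRing F e d) (FractionRing (GenericRing F e d))
    refine euclidRem_eq_of_combination (d := d) (S := fun j => (genericRemainder F e d j).map
      (algebraMap (GenericRing F e d) (FractionRing (GenericRing F e d)))) ?_ ?_ hk1 hkd
    · rw [degree_map_eq_of_injective hinj, genericB, alphBT, complete_singleton_X]
      exact degree_homPoly (coeff_zero_numSeries _) d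
    · intro j hj1 hjd
      obtain ⟨⟨U, V, hU, hUV⟩, hd, -⟩ := spec j hj1 hjd
      refine ⟨by rw [degree_map_eq_of_injective hinj, hd], U.map (algebraMap _ _),
        V.map (algebraMap _ _), by rwa [degree_map_eq_of_injective hinj], ?_⟩
      rw [hUV, Polynomial.map_add, Polynomial.map_mul, Polynomial.map_mul]
  · rw [leadingCoeff, hnat, hcoeff]
    exact det_toeplitz_ne_zero F e d _ hk1 hkd
  · intro Q
    rw [hlead, evalTS_eq, (evalTSHom_injective F e d).eq_iff]
  · intro h0
    rw [h0] at hcoeffP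
    simp [inVariable_eq] at hcoeffP
  -- The degree in the single variable `S^k(-𝔹)` already attains the upper bound for the total
  -- degree.
  · refine le_antisymm (totalDegree_leadingPoly_le _ _) ?_
    conv_lhs => rw [← hnatP]
    exact natDegree_inVariable_le _ _
  · rw [Monic, leadingCoeff, hnatP, hcoeffP]
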